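/- Let $X$ be a metric space with its Borel $\sigma$-algebra, $\mathcal C:X\times X\to\mathbb R$ a continuous cost function and $\varepsilon>0$. For Borel probability measures $\alpha,\beta$ on $X$ (of bounded support, if $X$ is not compact) put $$\mathrm{OT}_\varepsilon(\alpha,\beta)=\inf_{\pi}\Big\{\int_{X^2}\mathcal C\,d\pi+\varepsilon\,\mathrm{KL}(\pi\,|\,\alpha\otimes\beta)\Big\},\qquad S_\varepsilon(\alpha,\beta)=\mathrm{OT}_\varepsilon(\alpha,\beta)-\tfrac12\mathrm{OT}_\varepsilon(\alpha,\alpha)-\tfrac12\mathrm{OT}_\varepsilon(\beta,\beta),$$ where $\pi$ runs over the couplings of $\alpha$ and $\beta$, i.e. the probability measures on $X^2$ with marginals $\alpha$ and $\beta$, and $\mathrm{KL}(\pi\,|\,\alpha\otimes\beta)=\int\log\frac{d\pi}{d(\alpha\otimes\beta)}\,d\pi$ (and $+\infty$ if $\pi\not\ll\alpha\otimes\beta$). **(a) Compact case.** Suppose that $X$ is compact, that $\mathcal C$ is symmetric and Lipschitz, and that the kernel $k_\varepsilon(x,y)=\exp(-\mathcal C(x,y)/\varepsilon)$ is positive, i.e.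 $\sum_{i,j}c_ic_jk_\varepsilon(x_i,x_j)\ge 0$ for all finite families $x_i\in X$, $c_i\in\mathbb R$, and universal, i.e. the linear span of the functions $k_\varepsilon(x,\cdot)$, $x\in X$, is dense in $C(X)$ for the uniform norm. Then, for all Borel probability measures $\alpha,\beta,\alpha_n$ on $X$: 1. $S_\varepsilon(\alpha,\beta)=S_\varepsilon(\beta,\alpha)$, $\;0=S_\varepsilon(\beta,\beta)\le S_\varepsilon(\alpha,\beta)$, and $S_\varepsilon(\alpha,\beta)=0\iff\alpha=\beta$. 2. $S_\varepsilon$ is convex in each of its two variables. 3. $S_\varepsilon$ is smooth in the following sense: it is jointly continuous for weak convergence, and there are maps $(\alpha,\beta)\mapsto f_{\alpha,\beta}\in C(X)$ and $(\alpha,\beta)\mapsto g_{\alpha,\beta}\in C(X)$, jointly continuous from weak convergence to uniform convergence, such that for all differences $\xi=\rho-\rho'$, $\zeta=\sigma-\sigma'$ of probability measures on $X$, $$S_\varepsilon(\alpha+t\xi,\beta+t\zeta)=S_\varepsilon(\alpha,\beta)+t\Big(\int f_{\alpha,\beta}\,d\xi+\int g_{\alpha,\beta}\,d\zeta\Big)+o(t)$$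 as $t\to0$ along those real $t$ for which $\alpha+t\xi$ and $\beta+t\zeta$ are probability measures. 4. $S_\varepsilon$ metrizes weak convergence: $\alpha_n\rightharpoonup\alpha\iff S_\varepsilon(\alpha_n,\alpha)\to0$. **(b) Euclidean case.** Let $X=\mathbb R^d$, $\varepsilon>0$ and $\mathcal C(x,y)=\|x-y\|$ or $\mathcal C(x,y)=\|x-y\|^2$, with the Euclidean norm. Then the same conclusions hold for the probability measures of bounded support on $\mathbb R^d$: 1, 2 and the existence of gradients $f_{\alpha,\beta},g_{\alpha,\beta}\in C(\mathbb R^d)$ in 3 hold for all probability measures $\alpha,\beta,\rho,\rho',\sigma,\sigma'$ of bounded support; and, for each $R$, the continuity statements in 3 (with locally uniform convergence in $C(\mathbb R^d)$) and the equivalence 4 hold among the measures carried by the ball of radius $R$ centred at $0$. -/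

import Mathlib

open MeasureTheory Set Filter Topology

noncomputable section

namespace Sinkhorn

/-- A real symmetric kernel `k` is positive (semi-definite): all its Gram matrices are. -/
def IsPositiveKernel {X : Type*} (k : X → X → ℝ) : Prop :=
  (∀ x y, k x y = k y x) ∧
    ∀ (n : ℕ) (x : Fin n → X) (c : Fin n → ℝ), 0 ≤ ∑ i, ∑ j, c i * c j * k (x i) (x j)

/-- A kernel `k` (with continuous sections `k x`) on a compact space is universal: the linear
span of the functions `k x` is dense in `C(X, ℝ)` for the uniform norm. -/
def IsUniversalKernel {X : Type*} [TopologicalSpace X] (k : X → X → ℝ) : Prop :=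
  Dense {f : C(X, ℝ) | (f : X → ℝ) ∈ Submodule.span ℝ (range k)}

/-- The Gibbs kernel `exp (-C / ε)`. -/
def gibbsKernel {X : Type*} (C : X → X → ℝ) (ε : ℝ) (x y : X) : ℝ :=
  Real.exp (-C x y / ε)

section Divergence

variable {X : Type*} [MeasurableSpace X]

/-- Couplings of `α` and `β` whose relative entropy with respect to `α ⊗ β` is finite. Couplings
of infinite entropy have infinite regularized cost, and the product coupling has entropy zero. -/
def couplings (α β : ProbabilityMeasure X) : Set (Measure (X × X)) :=
  {π | π.map Prod.fst = (α : Measure X) ∧ π.map Prod.snd = (β : Measure X) ∧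
    InformationTheory.klDiv π ((α : Measure X).prod (β : Measure X)) ≠ ⊤}

/-- The entropic transport cost: the infimum over couplings `π` of
`∫ C dπ + ε KL(π | α ⊗ β)`. -/
def OT (C : X → X → ℝ) (ε : ℝ) (α β : ProbabilityMeasure X) : ℝ :=
  sInf ((fun π : Measure (X × X) =>
    ∫ p, C p.1 p.2 ∂π +
      ε * (InformationTheory.klDiv π ((α : Measure X).prod (β : Measure X))).toReal) ''
    couplings α β)

/-- The Sinkhorn divergence `S_ε`. -/
def divergence (C : X → X → ℝ) (ε : ℝ) (α β : ProbabilityMeasure X) : ℝ :=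
  OT C ε α β - OT C ε α α / 2 - OT C ε β β / 2

/-- The probability measures carried by `B`. -/
def carriedBy (B : Set X) : Set (ProbabilityMeasure X) :=
  {α | (α : Measure X) Bᶜ = 0}

/-- The probability measures of bounded support. -/
def boundedSupport (X : Type*) [MeasurableSpace X] [Bornology X] : Set (ProbabilityMeasure X) :=
  {α | ∃ B : Set X, Bornology.IsBounded B ∧ α ∈ carriedBy B}

/-- `α' = α + t (ρ - ρ')`, as an equality of signed measures. -/
def IsDisplaced (α ρ ρ' : ProbabilityMeasure X) (t : ℝ) (α' : ProbabilityMeasure X) : Prop :=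
  (α' : Measure X).toSignedMeasure = (α : Measure X).toSignedMeasure +
    t • ((ρ : Measure X).toSignedMeasure - (ρ' : Measure X).toSignedMeasure)

variable [TopologicalSpace X]

/-- The pair of continuous functions `(f, g)` is a gradient of `S` at `(α, β)`, among the
probability measures in the class `A`: for all displacements `ξ = ρ - ρ'` and `ζ = σ - σ'`,
`S (α + t ξ, β + t ζ) = S (α, β) + t (⟨ξ, f⟩ + ⟨ζ, g⟩) + o(t)`
as `t → 0` along those real `t` for which both arguments are probability measures. -/
def IsGradientAt (S : ProbabilityMeasure X → ProbabilityMeasure X → ℝ)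
    (A : Set (ProbabilityMeasure X)) (α β : ProbabilityMeasure X) (f g : C(X, ℝ)) : Prop :=
  ∀ ρ ∈ A, ∀ ρ' ∈ A, ∀ σ ∈ A, ∀ σ' ∈ A, ∀ δ > (0 : ℝ), ∃ η > (0 : ℝ), ∀ t : ℝ, |t| < η →
    ∀ α' β' : ProbabilityMeasure X, IsDisplaced α ρ ρ' t α' → IsDisplaced β σ σ' t β' →
      |S α' β' - S α β -
        t * ((∫ x, f x ∂(ρ : Measure X) - ∫ x, f x ∂(ρ' : Measure X)) +
          (∫ x, g x ∂(σ : Measure X) - ∫ x, g x ∂(σ' : Measure X)))| ≤ δ * |t|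

variable [OpensMeasurableSpace X]

/-- `S` is a symmetric positive definite, smooth loss function on the class `A` of probability
measures, convex in each variable, which metrizes weak convergence. Topological properties are
required on each of the subclasses in `𝓕`; sets of probability measures carry the topology of
weak convergence, and `C(X, ℝ)` that of locally uniform convergence. -/
structure IsSmoothConvexDivergence (S : ProbabilityMeasure X → ProbabilityMeasure X → ℝ)
    (A : Set (ProbabilityMeasure X)) (𝓕 : Set (Set (ProbabilityMeasure X))) : Prop where
  symm : ∀ α ∈ A, ∀ β ∈ A, S α β = S β α
  self : ∀ β ∈ A, S β β = 0
  nonneg : ∀ α ∈ A, ∀ β ∈ A, 0 ≤ S α β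
  eq_zero_iff : ∀ α ∈ A, ∀ β ∈ A, (S α β = 0 ↔ α = β)
  convex_left : ∀ α₀ ∈ A, ∀ α₁ ∈ A, ∀ β ∈ A, ∀ a b : ℝ, 0 ≤ a → 0 ≤ b → a + b = 1 →
    ∀ α : ProbabilityMeasure X,
      (α : Measure X) = ENNReal.ofReal a • (α₀ : Measure X) + ENNReal.ofReal b • (α₁ : Measure X) →
      S α β ≤ a * S α₀ β + b * S α₁ β
  convex_right : ∀ α ∈ A, ∀ β₀ ∈ A, ∀ β₁ ∈ A, ∀ a b : ℝ, 0 ≤ a → 0 ≤ b → a + b = 1 →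
    ∀ β : ProbabilityMeasure X,
      (β : Measure X) = ENNReal.ofReal a • (β₀ : Measure X) + ENNReal.ofReal b • (β₁ : Measure X) →
      S α β ≤ a * S α β₀ + b * S α β₁
  continuousOn : ∀ N ∈ 𝓕, ContinuousOn (fun p : ProbabilityMeasure X × ProbabilityMeasure X =>
    S p.1 p.2) (N ×ˢ N)
  smooth : ∃ G₁ G₂ : ProbabilityMeasure X → ProbabilityMeasure X → C(X, ℝ),
    (∀ α ∈ A, ∀ β ∈ A, IsGradientAt S A α β (G₁ α β) (G₂ α β)) ∧
    ∀ N ∈ 𝓕,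
      ContinuousOn (fun p : ProbabilityMeasure X × ProbabilityMeasure X => G₁ p.1 p.2) (N ×ˢ N) ∧
      ContinuousOn (fun p : ProbabilityMeasure X × ProbabilityMeasure X => G₂ p.1 p.2) (N ×ˢ N)
  metrizes : ∀ N ∈ 𝓕, ∀ (α : ℕ → ProbabilityMeasure X) (α' : ProbabilityMeasure X),
    (∀ n, α n ∈ N) → α' ∈ N →
      (Tendsto α atTop (nhds α') ↔ Tendsto (fun n => S (α n) α') atTop (nhds 0))

end Divergence

/-- The classes of measures on `ℝᵈ` carried by a common ball. -/
def commonBall (d : ℕ) : Set (Set (ProbabilityMeasure (EuclideanSpace ℝ (Fin d)))) :=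
  {N | ∃ R : ℝ, N = carriedBy (Metric.closedBall 0 R)}

end Sinkhorn

end

/-! Write `c = C / ε` and `k = exp (-c)`. Everything rests on the Schrödinger system of `(α, β)`:
continuous `f`, `g` such that `exp (f x + g y - c x y)` integrates to 1 in `y` against `β` for every
`x`, and in `x` against `α` for every `y`. Each equation says that one potential is the soft
transform of the other. On a compact set where `|c| ≤ M` this transform contracts oscillations by
the factor `1 - exp (-4M)`. Hence solutions exist, are unique up to a constant, and depend
continuously on `(α, β)` (`exists_isSchrodingerPair`, `stability`). Nonnegativity of relative
entropy shows that every pair of continuous functions bounds `OT` from below, and the coupling of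
density `exp (f ⊕ g - c)` attains `OT = ε (∫ f dα + ∫ g dβ)`.

For `β = α` there is a solution `(p, p)`, and it says that the `k`-potential of the measure `exp(p)
α` is `exp (-p)`. So this measure has energy 1, and its mutual energy with `exp(p') α'` is `∫ exp
(p' - p) dα'`. Positive definiteness of the energy makes that integral at most 1, with equality only
if `α' = α` (`integral_exp_sub_symmPotential`). Testing the dual problem of `OT α β` with the
symmetric potentials `p` of `α` and `q` of `β` yields `S α β ≥ ε (1 - ∫ exp (p - q) dα)`, hence
definiteness. The same comparison, with `1 + s ≤ exp s`, gives convexity.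

The potentials at `(α, β)` violate the dual normalization at displaced measures only to second
order, which bounds `OT` below to first order. The same bound taken from the displaced point back,
together with continuity of the potentials, bounds it above. Metrization follows from definiteness,
continuity and compactness.

It remains to see that the energy is positive definite. On a compact space, measures are
approximated by discrete ones and universality separates them. On Euclidean space, Gaussian kernels
are Fourier transforms of measures of positive density, and `exp (-r)` is a mixture of Gaussians. -/

noncomputable section

namespace Sinkhorn

/-! ### Integration over measures carried by a compact set -/

section Integration

variable {X : Type*} [TopologicalSpace X] [T2Space X]
  [MeasurableSpace X] [BorelSpace X] {B : Set X}

theorem integrable_of_continuous {μ : Measure X} [IsFiniteMeasure μ] (hB : IsCompact B)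
    (hμ : μ Bᶜ = 0) {φ : X → ℝ} (hφ : Continuous φ) : Integrable φ μ := by
  have h := hφ.continuousOn.integrableOn_compact (μ := μ) hB
  rwa [IntegrableOn, Measure.restrict_eq_self_of_ae_mem (mem_ae_iff.2 hμ)] at h

theorem integral_mono_of_carried {μ : Measure X} [IsFiniteMeasure μ] (hB : IsCompact B)
    (hμ : μ Bᶜ = 0) {φ ψ : X → ℝ} (hφ : Continuous φ) (hψ : Continuous ψ)
    (h : ∀ x ∈ B, φ x ≤ ψ x) : ∫ x, φ x ∂μ ≤ ∫ x, ψ x ∂μ :=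
  integral_mono_ae (integrable_of_continuous hB hμ hφ) (integrable_of_continuous hB hμ hψ)
    (Filter.mem_of_superset (mem_ae_iff.2 hμ) h)

theorem abs_integral_sub_le {μ : Measure X} [IsProbabilityMeasure μ] (hB : IsCompact B)
    (hμ : μ Bᶜ = 0) {φ ψ : X → ℝ} (hφ : Continuous φ) (hψ : Continuous ψ) {δ : ℝ}
    (h : ∀ x ∈ B, |φ x - ψ x| ≤ δ) : |∫ x, φ x ∂μ - ∫ x, ψ x ∂μ| ≤ δ := by
  rw [← integral_sub (integrable_of_continuous hB hμ hφ) (integrable_of_continuous hB hμ hψ)]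
  have := norm_integral_le_of_norm_le_const (μ := μ) (f := fun x => φ x - ψ x) (C := δ)
    (Filter.mem_of_superset (mem_ae_iff.2 hμ) h)
  simpa using this

/-- Integration is jointly continuous for measures carried by a compact set. -/
theorem continuousOn_integral (hB : IsCompact B) :
    ContinuousOn (fun p : ProbabilityMeasure X × C(X, ℝ) => ∫ y, p.2 y ∂(p.1 : Measure X))
      (carriedBy B ×ˢ univ) := by
  rintro ⟨α₀, φ₀⟩ ⟨h₀, -⟩
  obtain ⟨M, hM⟩ := hB.exists_bound_of_continuousOn φ₀.continuous.continuousOn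
  -- `φ₀` may be unbounded off `B`, while weak convergence only tests bounded functions; hence the
  -- truncation. The level is `|M|` because `M` may be negative when `B` is empty.
  let ψ : BoundedContinuousFunction X ℝ := BoundedContinuousFunction.ofNormedAddCommGroup
    (fun x => max (-|M|) (min |M| (φ₀ x))) (by fun_prop) |M| (by
      intro x
      rw [Real.norm_eq_abs, abs_le]
      refine ⟨le_max_left _ _, max_le (by linarith [abs_nonneg M]) (min_le_left _ _)⟩)
  have hψ : ∀ x ∈ B, ψ x = φ₀ x := by
    intro x hx
    have h1 := abs_le.1 ((hM x hx).trans (le_abs_self M))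
    change max (-|M|) (min |M| (φ₀ x)) = φ₀ x
    rw [min_eq_right h1.2, max_eq_right h1.1]
  have hψi : ∀ α : ProbabilityMeasure X, α ∈ carriedBy B →
      ∫ y, ψ y ∂(α : Measure X) = ∫ y, φ₀ y ∂(α : Measure X) := fun α hα =>
    integral_congr_ae (Filter.mem_of_superset (mem_ae_iff.2 hα) hψ)
  have hw : Tendsto (fun α : ProbabilityMeasure X => ∫ y, ψ y ∂(α : Measure X)) (𝓝 α₀)
      (𝓝 (∫ y, ψ y ∂(α₀ : Measure X))) :=
    (ProbabilityMeasure.tendsto_iff_forall_integral_tendsto.1 tendsto_id) ψ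
  rw [ContinuousWithinAt, Metric.tendsto_nhds]
  intro δ hδ
  have hφ : ∀ᶠ φ : C(X, ℝ) in 𝓝 φ₀, ∀ x ∈ B, dist (φ₀ x) (φ x) < δ / 2 := by
    have := (ContinuousMap.tendsto_iff_forall_isCompact_tendstoUniformlyOn (f := φ₀)
      (F := fun φ : C(X, ℝ) => φ)).1 tendsto_id B hB
    exact Metric.tendstoUniformlyOn_iff.1 this (δ / 2) (by positivity)
  have hw' := Metric.tendsto_nhds.1 hw (δ / 2) (by positivity)
  rw [nhdsWithin, nhds_prod_eq]
  filter_upwards [mem_inf_of_left (prod_mem_prod hw' hφ),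
    mem_inf_of_right (mem_principal_self _)] with p hp hpB
  have e1 : |∫ y, p.2 y ∂(p.1 : Measure X) - ∫ y, φ₀ y ∂(p.1 : Measure X)| ≤ δ / 2 :=
    abs_integral_sub_le hB hpB.1 p.2.continuous φ₀.continuous fun x hx => by
      have := hp.2 x hx
      rw [dist_comm, Real.dist_eq] at this
      exact this.le
  have e2 : |∫ y, ψ y ∂(p.1 : Measure X) - ∫ y, ψ y ∂(α₀ : Measure X)| < δ / 2 := hp.1
  rw [hψi _ hpB.1, hψi _ h₀] at e2
  rw [Real.dist_eq]
  calc _ ≤ _ := abs_sub_le _ (∫ y, φ₀ y ∂(p.1 : Measure X)) _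
    _ < δ := by linarith

end Integration

/-! ### The soft transform and its contraction property -/

section Softmin

variable {X : Type*} [MeasurableSpace X]

/-- The soft `c`-transform `x ↦ -log ∫ exp (f y - c x y) dα(y)`. -/
def softmin (c : X → X → ℝ) (α : Measure X) (f : X → ℝ) (x : X) : ℝ :=
  -Real.log (∫ y, Real.exp (f y - c x y) ∂α)

variable [TopologicalSpace X] [T2Space X] [BorelSpace X] {B : Set X}
  {c : X → X → ℝ}

theorem integrable_exp_sub (hc : Continuous fun p : X × X => c p.1 p.2) {α : Measure X}
    [IsFiniteMeasure α] (hB : IsCompact B) (hα : α Bᶜ = 0) {f : X → ℝ} (hf : Continuous f)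
    (x : X) : Integrable (fun y => Real.exp (f y - c x y)) α :=
  integrable_of_continuous hB hα (by fun_prop)

theorem integral_exp_sub_pos (hc : Continuous fun p : X × X => c p.1 p.2) {α : Measure X}
    [IsProbabilityMeasure α] (hB : IsCompact B) (hα : α Bᶜ = 0) {f : X → ℝ} (hf : Continuous f)
    (x : X) : 0 < ∫ y, Real.exp (f y - c x y) ∂α :=
  integral_exp_pos (integrable_exp_sub hc hB hα hf x)

theorem exp_neg_softmin (hc : Continuous fun p : X × X => c p.1 p.2) {α : Measure X}
    [IsProbabilityMeasure α] (hB : IsCompact B) (hα : α Bᶜ = 0) {f : X → ℝ} (hf : Continuous f)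
    (x : X) : Real.exp (-softmin c α f x) = ∫ y, Real.exp (f y - c x y) ∂α := by
  rw [softmin, neg_neg, Real.exp_log (integral_exp_sub_pos hc hB hα hf x)]

theorem softmin_add_const (hc : Continuous fun p : X × X => c p.1 p.2) {α : Measure X}
    [IsProbabilityMeasure α] (hB : IsCompact B) (hα : α Bᶜ = 0) {f : X → ℝ} (hf : Continuous f)
    (s : ℝ) (x : X) : softmin c α (fun y => f y + s) x = softmin c α f x - s := by
  have h : ∀ y, Real.exp (f y + s - c x y) = Real.exp s * Real.exp (f y - c x y) := fun y => by
    rw [← Real.exp_add]; ring_nf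
  simp only [softmin, h]
  rw [integral_const_mul, Real.log_mul (Real.exp_pos s).ne'
    (integral_exp_sub_pos hc hB hα hf x).ne', Real.log_exp]
  ring

/-- The soft transform is jointly continuous in the measure, the function and the point. -/
theorem continuous_softmin_joint (hc : Continuous fun p : X × X => c p.1 p.2)
    (hB : IsCompact B) :
    Continuous fun p : (↥(carriedBy (X := X) B) × C(X, ℝ)) × X =>
      softmin c (p.1.1 : ProbabilityMeasure X) p.1.2 p.2 := by
  -- Currying makes the section `c x` a continuous function of `x` for the compact-open topology, so
  -- the integrand depends continuously on the pair (function, point).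
  let cc : C(X, C(X, ℝ)) := ContinuousMap.curry ⟨fun p : X × X => c p.1 p.2, hc⟩
  let E : C(ℝ, ℝ) := ⟨Real.exp, Real.continuous_exp⟩
  have h1 : Continuous fun p : (↥(carriedBy (X := X) B) × C(X, ℝ)) × X =>
      ((p.1.1 : ProbabilityMeasure X), E.comp (p.1.2 - cc p.2)) := by
    refine (by fun_prop : Continuous _).prodMk ?_
    exact (ContinuousMap.continuous_postcomp E).comp (by fun_prop)
  have h2 := (continuousOn_integral hB).comp_continuous h1 (fun p => ⟨p.1.1.2, mem_univ _⟩)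
  refine (h2.log fun p => ?_).neg
  exact (integral_exp_sub_pos hc hB p.1.1.2 p.1.2.continuous p.2).ne'

theorem continuous_softmin (hc : Continuous fun p : X × X => c p.1 p.2) {α : ProbabilityMeasure X}
    (hB : IsCompact B) (hα : α ∈ carriedBy B) {f : X → ℝ} (hf : Continuous f) :
    Continuous (softmin c (α : Measure X) f) :=
  (continuous_softmin_joint hc hB).comp
    (f := fun x => (((⟨α, hα⟩ : ↥(carriedBy B)), (⟨f, hf⟩ : C(X, ℝ))), x)) (by fun_prop)

/-- The soft transform, as a jointly continuous map with values in `C(X, ℝ)`. -/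
def softminMap (hc : Continuous fun p : X × X => c p.1 p.2) (hB : IsCompact B) :
    C(↥(carriedBy (X := X) B) × C(X, ℝ), C(X, ℝ)) :=
  ContinuousMap.curry ⟨_, continuous_softmin_joint hc hB⟩

section Contraction

variable {α : Measure X} [IsProbabilityMeasure α] {f g : X → ℝ}

theorem integral_exp_le_of_le (hc : Continuous fun p : X × X => c p.1 p.2) (hB : IsCompact B)
    (hα : α Bᶜ = 0) (hf : Continuous f) (hg : Continuous g) {m : ℝ}
    (h : ∀ y ∈ B, f y ≤ g y + m) (x : X) :
    ∫ y, Real.exp (f y - c x y) ∂α ≤ Real.exp m * ∫ y, Real.exp (g y - c x y) ∂α := by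
  rw [← integral_const_mul]
  refine integral_mono_of_carried hB hα (by fun_prop) (by fun_prop) fun y hy => ?_
  rw [← Real.exp_add, Real.exp_le_exp]
  linarith [h y hy]

theorem softmin_sub_le (hc : Continuous fun p : X × X => c p.1 p.2) (hB : IsCompact B)
    (hα : α Bᶜ = 0) (hf : Continuous f) (hg : Continuous g) {m : ℝ}
    (h : ∀ y ∈ B, f y ≤ g y + m) (x : X) : softmin c α g x ≤ softmin c α f x + m := by
  have := integral_exp_le_of_le hc hB hα hf hg h x
  rw [← exp_neg_softmin hc hB hα hf, ← exp_neg_softmin hc hB hα hg, ← Real.exp_add,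
    Real.exp_le_exp] at this
  linarith

/-- The soft transform does not increase oscillations. -/
theorem softmin_osc_le (hc : Continuous fun p : X × X => c p.1 p.2) (hB : IsCompact B)
    (hα : α Bᶜ = 0) (hf : Continuous f) (hg : Continuous g) {D : ℝ}
    (h : ∀ y ∈ B, ∀ y' ∈ B, (f y - g y) - (f y' - g y') ≤ D) (x x' : X) :
    (softmin c α f x - softmin c α g x) - (softmin c α f x' - softmin c α g x') ≤ D := by
  have hne : B.Nonempty := by
    by_contra hne
    rw [not_nonempty_iff_eq_empty] at hne
    simp [hne] at hα
  obtain ⟨y₀, hy₀, hmin⟩ := hB.exists_isMinOn hne (hf.sub hg).continuousOn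
  have h1 := softmin_sub_le hc hB hα hf hg (m := f y₀ - g y₀ + D) (fun y hy => by
    linarith [h y hy y₀ hy₀]) x'
  have h2 := softmin_sub_le hc hB hα hg hf (m := -(f y₀ - g y₀)) (fun y hy => by
    have : f y₀ - g y₀ ≤ f y - g y := hmin hy
    linarith) x
  linarith

/-- Bernoulli's inequality for the exponent `δ ≤ 1` gives `a' ^ δ ≤ 1 + δ (a' - 1) ≤ a`. Thus a
contraction of the excess over 1 passes to logarithms. -/
theorem log_sub_log_le_of_contraction {a a' δ D : ℝ} (ha' : 1 ≤ a') (hD : a' ≤ Real.exp D)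
    (hδ : 0 < δ) (hδ1 : δ ≤ 1) (h : δ * (a' - 1) ≤ a - 1) :
    Real.log a' - Real.log a ≤ (1 - δ) * D := by
  have h0 : 0 < a' := by linarith
  have h1 : a' ^ δ ≤ 1 + δ * (a' - 1) := by
    have := rpow_one_add_le_one_add_mul_self (s := a' - 1) (by linarith) hδ.le hδ1
    simpa using this
  have h2 : δ * Real.log a' ≤ Real.log a := by
    rw [← Real.log_rpow h0]
    exact Real.log_le_log (Real.rpow_pos_of_pos h0 δ) (by linarith)
  have h3 : Real.log a' ≤ D := (Real.log_le_iff_le_exp h0).2 hD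
  nlinarith [Real.log_nonneg ha']

/-- The soft transform is a strict contraction for the oscillation seminorm. -/
theorem softmin_osc_contraction (hc : Continuous fun p : X × X => c p.1 p.2) (hB : IsCompact B)
    (hα : α Bᶜ = 0) (hf : Continuous f) (hg : Continuous g) {D M : ℝ}
    (hM : ∀ x ∈ B, ∀ y ∈ B, |c x y| ≤ M)
    (h : ∀ y ∈ B, ∀ y' ∈ B, (f y - g y) - (f y' - g y') ≤ D) :
    ∀ x ∈ B, ∀ x' ∈ B, (softmin c α f x - softmin c α g x) -
      (softmin c α f x' - softmin c α g x') ≤ (1 - Real.exp (-4 * M)) * D := by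
  intro x' hx' x hx
  obtain ⟨y₀, hy₀, hmin⟩ := hB.exists_isMinOn ⟨x, hx⟩ (hf.sub hg).continuousOn
  -- With `m` the minimum of `f - g`, the function `exp f - exp (m + g)` is nonnegative on `B`. Its
  -- integral against `exp (-c x ·)` therefore changes by a factor at most `exp (2M)` when `x`
  -- moves.
  set m := f y₀ - g y₀ with hm
  have hmin' : ∀ y ∈ B, m ≤ f y - g y := fun y hy => hmin hy
  have hM0 : 0 ≤ M := (abs_nonneg _).trans (hM x hx x hx)
  have key : Real.exp (-2 * M) * (∫ y, Real.exp (f y - c x y) ∂α -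
      Real.exp m * ∫ y, Real.exp (g y - c x y) ∂α) ≤ ∫ y, Real.exp (f y - c x' y) ∂α -
      Real.exp m * ∫ y, Real.exp (g y - c x' y) ∂α := by
    rw [← integral_const_mul, ← integral_const_mul, ← integral_sub, ← integral_sub,
      ← integral_const_mul]
    · refine integral_mono_of_carried hB hα (by fun_prop) (by fun_prop) fun y hy => ?_
      have e1 : Real.exp (f y - c x y) - Real.exp m * Real.exp (g y - c x y) =
        Real.exp (-c x y) * (Real.exp (f y) - Real.exp (m + g y)) := by
        rw [mul_sub, ← Real.exp_add, ← Real.exp_add, ← Real.exp_add]; ring_nf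
      have e2 : Real.exp (f y - c x' y) - Real.exp m * Real.exp (g y - c x' y) =
        Real.exp (-c x' y) * (Real.exp (f y) - Real.exp (m + g y)) := by
        rw [mul_sub, ← Real.exp_add, ← Real.exp_add, ← Real.exp_add]; ring_nf
      rw [e1, e2, ← mul_assoc, ← Real.exp_add]
      refine mul_le_mul_of_nonneg_right ?_ ?_
      · rw [Real.exp_le_exp]
        linarith [(abs_le.1 (hM x hx y hy)).1, (abs_le.1 (hM x' hx' y hy)).2]
      · rw [sub_nonneg, Real.exp_le_exp]
        linarith [hmin' y hy]
    all_goals exact integrable_of_continuous hB hα (by fun_prop)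
  have key2 : ∫ y, Real.exp (g y - c x' y) ∂α ≤
      Real.exp (2 * M) * ∫ y, Real.exp (g y - c x y) ∂α := by
    rw [← integral_const_mul]
    refine integral_mono_of_carried hB hα (by fun_prop) (by fun_prop) fun y hy => ?_
    rw [← Real.exp_add, Real.exp_le_exp]
    linarith [(abs_le.1 (hM x hx y hy)).2, (abs_le.1 (hM x' hx' y hy)).1]
  have lo := integral_exp_le_of_le hc hB hα hg hf (m := -m) (fun y hy => by
    linarith [hmin' y hy]) x
  have hi := integral_exp_le_of_le hc hB hα hf hg (m := m + D) (fun y hy => by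
    linarith [h y hy y₀ hy₀]) x
  have pf := integral_exp_sub_pos hc hB hα hf x
  have pg := integral_exp_sub_pos hc hB hα hg x
  have pf' := integral_exp_sub_pos hc hB hα hf x'
  have pg' := integral_exp_sub_pos hc hB hα hg x'
  simp only [softmin]
  set F := ∫ y, Real.exp (f y - c x y) ∂α
  set G := ∫ y, Real.exp (g y - c x y) ∂α
  set F' := ∫ y, Real.exp (f y - c x' y) ∂α
  set G' := ∫ y, Real.exp (g y - c x' y) ∂α
  have em := Real.exp_pos m
  have lo' : Real.exp m * G ≤ F := by
    rw [Real.exp_neg] at lo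
    rwa [inv_mul_eq_div, le_div_iff₀ em, mul_comm] at lo
  -- Both quotients are normalized by `exp (-m)` so as to be at least 1. One factor `exp (-2M)`
  -- comes from the excesses (`key`), the other from the denominators (`key2`).
  have H : Real.log (F / G * Real.exp (-m)) - Real.log (F' / G' * Real.exp (-m)) ≤
      (1 - Real.exp (-4 * M)) * D := by
    refine log_sub_log_le_of_contraction ?_ ?_ (Real.exp_pos _) ?_ ?_
    · rw [Real.exp_neg, ← div_eq_mul_inv, le_div_iff₀ em, le_div_iff₀ pg]
      linarith
    · rw [Real.exp_neg, ← div_eq_mul_inv, div_le_iff₀ em, div_le_iff₀ pg, ← Real.exp_add]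
      rw [add_comm D m]; exact hi
    · rw [Real.exp_le_one_iff]; linarith
    · have a1 : F / G * Real.exp (-m) - 1 = (F - Real.exp m * G) / (G * Real.exp m) := by
        rw [Real.exp_neg]; field_simp
      have a2 : F' / G' * Real.exp (-m) - 1 = (F' - Real.exp m * G') / (G' * Real.exp m) := by
        rw [Real.exp_neg]; field_simp
      rw [a1, a2, le_div_iff₀ (by positivity), mul_div_assoc', div_mul_eq_mul_div,
        div_le_iff₀ (by positivity)]
      have e4 : Real.exp (-4 * M) = Real.exp (-2 * M) * Real.exp (-(2 * M)) := by
        rw [← Real.exp_add]; ring_nf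
      have k2 : Real.exp (-(2 * M)) * G' ≤ G := by
        rw [Real.exp_neg, inv_mul_le_iff₀ (Real.exp_pos _)]; exact key2
      rw [e4]
      have nn : 0 ≤ F - Real.exp m * G := by linarith
      have nn' := (mul_nonneg (Real.exp_pos (-2 * M)).le nn).trans key
      calc _ = (Real.exp (-2 * M) * (F - Real.exp m * G)) * (Real.exp (-(2 * M)) * G') *
            Real.exp m := by ring
        _ ≤ (F' - Real.exp m * G') * G * Real.exp m := by gcongr
        _ = _ := by ring
  rw [Real.log_mul (by positivity) (by positivity), Real.log_mul (by positivity) (by positivity),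
    Real.log_div pf.ne' pg.ne', Real.log_div pf'.ne' pg'.ne'] at H
  linarith

end Contraction

end Softmin

/-! ### Schrödinger potentials: existence, uniqueness, continuity -/

section Potentials

theorem carriedBy_mono {X : Type*} [MeasurableSpace X] {B B' : Set X} (h : B ⊆ B') :
    carriedBy B ⊆ (carriedBy B' : Set (ProbabilityMeasure X)) := fun _ hα =>
  measure_mono_null (compl_subset_compl.2 h) hα

theorem exists_abs_le_of_isCompact {X : Type*} [TopologicalSpace X] {B : Set X}
    {c : X → X → ℝ} (hc : Continuous fun p : X × X => c p.1 p.2)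
    (hB : IsCompact B) : ∃ M, ∀ x ∈ B, ∀ y ∈ B, |c x y| ≤ M := by
  obtain ⟨M, hM⟩ := (hB.prod hB).exists_bound_of_continuousOn hc.continuousOn
  exact ⟨M, fun x hx y hy => hM (x, y) ⟨hx, hy⟩⟩

variable {X : Type*} [MeasurableSpace X] [TopologicalSpace X]

/-- A pair of continuous functions solving the Schrödinger system of `(α, β)`, everywhere. -/
structure IsSchrodingerPair (c : X → X → ℝ) (α β : Measure X) (f g : X → ℝ) : Prop where
  continuous_left : Continuous f
  continuous_right : Continuous g
  left : ∀ x, softmin c β g x = f x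
  right : ∀ y, softmin c α f y = g y

theorem IsSchrodingerPair.swap {c : X → X → ℝ} {α β : Measure X} {f g : X → ℝ}
    (h : IsSchrodingerPair c α β f g) : IsSchrodingerPair c β α g f :=
  ⟨h.continuous_right, h.continuous_left, h.right, h.left⟩

variable [T2Space X] [BorelSpace X] {B : Set X} {c : X → X → ℝ}

namespace IsSchrodingerPair

variable {α β : Measure X} {f g : X → ℝ}

theorem integral_right [IsProbabilityMeasure β] (h : IsSchrodingerPair c α β f g)
    (hc : Continuous fun p : X × X => c p.1 p.2) (hB : IsCompact B) (hβ : β Bᶜ = 0) (x : X) :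
    ∫ y, Real.exp (f x + g y - c x y) ∂β = 1 := by
  have e : ∀ y, Real.exp (f x + g y - c x y) = Real.exp (f x) * Real.exp (g y - c x y) :=
    fun y => by rw [← Real.exp_add]; ring_nf
  simp only [e]
  rw [integral_const_mul, ← exp_neg_softmin hc hB hβ h.continuous_right, h.left, ← Real.exp_add]
  simp

theorem integral_left [IsProbabilityMeasure α] (h : IsSchrodingerPair c α β f g)
    (hc : Continuous fun p : X × X => c p.1 p.2) (hsymm : ∀ x y, c x y = c y x)
    (hB : IsCompact B) (hα : α Bᶜ = 0) (y : X) :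
    ∫ x, Real.exp (f x + g y - c x y) ∂α = 1 := by
  have := h.swap.integral_right hc hB hα y
  simpa only [add_comm (g y), hsymm y] using this

variable [IsProbabilityMeasure α] [IsProbabilityMeasure β]

/-- Solutions of Schrödinger systems are stable, modulo constants. -/
theorem stability {α' β' : Measure X} {f' g' : X → ℝ} (h : IsSchrodingerPair c α β f g)
    (h' : IsSchrodingerPair c α' β' f' g') (hc : Continuous fun p : X × X => c p.1 p.2)
    (hB : IsCompact B) (hα : α Bᶜ = 0) (hβ : β Bᶜ = 0) {M : ℝ}
    (hM : ∀ x ∈ B, ∀ y ∈ B, |c x y| ≤ M) {D₁ D₂ : ℝ}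
    (h₁ : ∀ x ∈ B, ∀ x' ∈ B,
      (softmin c α f' x - g' x) - (softmin c α f' x' - g' x') ≤ D₁)
    (h₂ : ∀ x ∈ B, ∀ x' ∈ B,
      (softmin c β g' x - f' x) - (softmin c β g' x' - f' x') ≤ D₂) :
    ∀ x ∈ B, ∀ x' ∈ B, (f x - f' x) - (f x' - f' x') ≤ (D₁ + D₂) / Real.exp (-4 * M) := by
  intro x hx x' hx'
  have hcont : ContinuousOn (fun x => f x - f' x) B :=
    (h.continuous_left.sub h'.continuous_left).continuousOn
  obtain ⟨y, hy, hmax⟩ := hB.exists_isMaxOn ⟨x, hx⟩ hcont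
  obtain ⟨z, hz, hmin⟩ := hB.exists_isMinOn ⟨x, hx⟩ hcont
  set D := (f y - f' y) - (f z - f' z) with hD
  have hosc : ∀ x ∈ B, ∀ x' ∈ B, (f x - f' x) - (f x' - f' x') ≤ D := fun x hx x' hx' => by
    have h1 : f x - f' x ≤ f y - f' y := hmax hx
    have h2 : f z - f' z ≤ f x' - f' x' := hmin hx'
    linarith
  -- `g - g'` is a difference of two transforms, which contracts, plus the residual of `(f', g')` in
  -- the system of `(α, β)`. Transforming back adds the second residual, so `D ≤ (1 - exp (-4M)) D +
  -- D₁ + D₂`.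
  have hg : ∀ x ∈ B, ∀ x' ∈ B, (g x - g' x) - (g x' - g' x') ≤
      (1 - Real.exp (-4 * M)) * D + D₁ := fun x hx x' hx' => by
    have := softmin_osc_contraction hc hB hα h.continuous_left h'.continuous_left hM hosc
      x hx x' hx'
    rw [h.right, h.right] at this
    linarith [h₁ x hx x' hx']
  have hf := softmin_osc_le hc hB hβ h.continuous_right h'.continuous_right hg y z
  rw [h.left, h.left] at hf
  have := h₂ y hy z hz
  refine (hosc x hx x' hx').trans ?_
  rw [le_div_iff₀ (Real.exp_pos _)]
  linarith

/-- Solutions of a Schrödinger system are unique up to a constant. -/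
theorem unique {f' g' : X → ℝ} (h : IsSchrodingerPair c α β f g)
    (h' : IsSchrodingerPair c α β f' g') (hc : Continuous fun p : X × X => c p.1 p.2)
    (hB : IsCompact B) (hα : α Bᶜ = 0) (hβ : β Bᶜ = 0) (x x' : X) :
    f x - f' x = f x' - f' x' := by
  -- The system holds at every point, so the carrier may be enlarged to contain any two given
  -- points.
  have hB' : IsCompact (insert x (insert x' B)) := (hB.insert x').insert x
  have hsub : (insert x (insert x' B))ᶜ ⊆ Bᶜ :=
    compl_subset_compl.2 ((subset_insert _ _).trans (subset_insert _ _))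
  obtain ⟨M, hM⟩ := exists_abs_le_of_isCompact hc hB'
  have := h.stability h' hc hB' (measure_mono_null hsub hα) (measure_mono_null hsub hβ) hM
    (D₁ := 0) (D₂ := 0) (fun y _ y' _ => by simp [h'.right]) (fun y _ y' _ => by simp [h'.left])
  rw [add_zero, zero_div] at this
  have h1 := this x (by simp) x' (by simp)
  have h2 := this x' (by simp) x (by simp)
  linarith

end IsSchrodingerPair

variable [SecondCountableTopology X]

/-- Picard iteration of the two transforms composed, renormalized at `x₀`, converges geometrically.
The limit solves the system up to an additive constant, which vanishes because the Gibbs density has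
the same mass in either order of integration. -/
theorem exists_isSchrodingerPair (hc : Continuous fun p : X × X => c p.1 p.2)
    (hsymm : ∀ x y, c x y = c y x) (hB : IsCompact B) {α β : ProbabilityMeasure X}
    (hα : α ∈ carriedBy B) (hβ : β ∈ carriedBy B) (x₀ : X) :
    ∃ f g : X → ℝ, IsSchrodingerPair c (α : Measure X) (β : Measure X) f g ∧ f x₀ = 0 := by
  wlog hx₀ : x₀ ∈ B generalizing B
  · exact this (hB.insert x₀) (carriedBy_mono (subset_insert _ _) hα)
      (carriedBy_mono (subset_insert _ _) hβ) (mem_insert _ _)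
  obtain ⟨M, hM⟩ := exists_abs_le_of_isCompact hc hB
  let T : ↥(carriedBy B) → C(X, ℝ) → C(X, ℝ) := fun a f => softminMap hc hB (a, f)
  have hT : ∀ a, Continuous (T a) := fun a => by
    exact (softminMap hc hB).continuous.comp (by fun_prop)
  let Θ : C(X, ℝ) → C(X, ℝ) := fun f => T ⟨β, hβ⟩ (T ⟨α, hα⟩ f)
  have hΘ : Continuous Θ := (hT _).comp (hT _)
  let Φ : C(X, ℝ) → C(X, ℝ) := fun f => Θ f - ContinuousMap.const X (Θ f x₀)
  have hΦ : Continuous Φ := by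
    refine hΘ.sub (ContinuousMap.continuous_const'.comp ?_)
    exact (continuous_eval_const x₀).comp hΘ
  set κ := 1 - Real.exp (-4 * M) with hκ
  have hM0 : 0 ≤ M := (abs_nonneg _).trans (hM x₀ hx₀ x₀ hx₀)
  have hκ0 : 0 ≤ κ := by
    have : Real.exp (-4 * M) ≤ 1 := Real.exp_le_one_iff.2 (by linarith)
    linarith
  have hκ1 : κ < 1 := by linarith [Real.exp_pos (-4 * M)]
  -- The hypothesis concerns `B` only, but the conclusion holds on all of `X`, since a transform
  -- only sees its argument on the carrier. With the normalization at `x₀`, this yields uniform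
  -- convergence even if `X` is not compact.
  have hstep : ∀ (f f' : C(X, ℝ)) (D : ℝ),
      (∀ x ∈ B, ∀ x' ∈ B, (f x - f' x) - (f x' - f' x') ≤ D) →
      ∀ x x', (Φ f x - Φ f' x) - (Φ f x' - Φ f' x') ≤ κ * D := by
    intro f f' D h x x'
    have h1 := softmin_osc_contraction hc hB hα f.continuous f'.continuous hM h
    have h2 := softmin_osc_le hc hB hβ (T ⟨α, hα⟩ f).continuous (T ⟨α, hα⟩ f').continuous h1 x x'
    have e : ∀ (f : C(X, ℝ)) (x : X),
      Φ f x = softmin c (β : Measure X) (T ⟨α, hα⟩ f) x - Θ f x₀ := fun _ _ => rfl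
    simp only [e]
    linarith
  let u : ℕ → C(X, ℝ) := fun n => Φ^[n] 0
  have hu : ∀ n, u (n + 1) = Φ (u n) := fun n => Function.iterate_succ_apply' Φ n 0
  have hu0 : ∀ n, u n x₀ = 0 := by
    intro n
    cases n with
    | zero => rfl
    | succ n => rw [hu]; simp [Φ]
  obtain ⟨D, hD⟩ := hB.exists_bound_of_continuousOn (u 1).continuous.continuousOn
  have hosc : ∀ n, ∀ x ∈ B, ∀ x' ∈ B,
      (u (n + 1) x - u n x) - (u (n + 1) x' - u n x') ≤ κ ^ n * (2 * D) := by
    intro n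
    induction n with
    | zero =>
      intro x hx x' hx'
      have e : ∀ x, u 0 x = 0 := fun _ => rfl
      have h1 := abs_le.1 (hD x hx)
      have h2 := abs_le.1 (hD x' hx')
      rw [e, e, pow_zero]
      simp only [zero_add]
      linarith
    | succ n ih =>
      intro x _ x' _
      rw [hu (n + 1), hu n, pow_succ', mul_assoc]
      exact hstep _ _ _ (by rw [← hu]; exact ih) x x'
  have hdist : ∀ x n, dist (u (n + 1) x) (u (n + 1 + 1) x) ≤ κ * (2 * D) * κ ^ n := by
    intro x n
    have h1 := hstep _ _ _ (hosc n) x x₀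
    have h2 := hstep _ _ _ (hosc n) x₀ x
    rw [← hu, ← hu, hu0, hu0] at h1 h2
    rw [dist_comm, Real.dist_eq, abs_le]
    constructor <;> linarith
  have hcauchy : ∀ x, CauchySeq fun n => u (n + 1) x := fun x =>
    cauchySeq_of_le_geometric κ _ hκ1 (hdist x)
  choose v hv using fun x => cauchySeq_tendsto_of_complete (hcauchy x)
  have hunif : TendstoUniformly (fun n x => u (n + 1) x) v atTop := by
    rw [Metric.tendstoUniformly_iff]
    intro δ hδ
    have hlim : Tendsto (fun n : ℕ => κ * (2 * D) * κ ^ n / (1 - κ)) atTop (𝓝 0) := by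
      have := ((tendsto_pow_atTop_nhds_zero_of_lt_one hκ0 hκ1).const_mul
        (κ * (2 * D))).div_const (1 - κ)
      simpa using this
    filter_upwards [hlim.eventually (gt_mem_nhds hδ)] with n hn x
    rw [dist_comm]
    exact (dist_le_of_le_geometric_of_tendsto κ _ hκ1 (hdist x) (hv x) n).trans_lt hn
  let V : C(X, ℝ) := ⟨v, hunif.continuous
    (Frequently.of_forall fun n => (u (n + 1)).continuous)⟩
  have hV : Tendsto (fun n => u (n + 1)) atTop (𝓝 V) :=
    ContinuousMap.tendsto_of_tendstoLocallyUniformly hunif.tendstoLocallyUniformly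
  have hfix : Φ V = V := by
    refine tendsto_nhds_unique ((hΦ.tendsto V).comp hV) ?_
    have := hV.comp (tendsto_add_atTop_nat 1)
    refine this.congr fun n => ?_
    exact hu (n + 1)
  set s := Θ V x₀ with hs
  have hV0 : V x₀ = 0 := by
    rw [← hfix]
    exact sub_self (Θ V x₀)
  set W := T ⟨α, hα⟩ V with hW
  have h1 : ∀ x, softmin c (β : Measure X) W x = V x + s := fun x => by
    have : Φ V x = softmin c (β : Measure X) W x - s := rfl
    rw [hfix] at this
    linarith
  have hleft : ∀ y, ∫ x, Real.exp (V x + W y - c x y) ∂(α : Measure X) = 1 := fun y => by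
    have e : ∀ x, Real.exp (V x + W y - c x y) = Real.exp (W y) * Real.exp (V x - c y x) :=
      fun x => by rw [← Real.exp_add, hsymm x y]; ring_nf
    simp only [e]
    rw [integral_const_mul, ← exp_neg_softmin hc hB hα V.continuous, ← Real.exp_add]
    exact Real.exp_eq_one_iff _ |>.2 (add_neg_cancel (W y))
  have hright : ∀ x, ∫ y, Real.exp (V x + W y - c x y) ∂(β : Measure X) = Real.exp (-s) :=
    fun x => by
    have e : ∀ y, Real.exp (V x + W y - c x y) = Real.exp (V x) * Real.exp (W y - c x y) :=
      fun y => by rw [← Real.exp_add]; ring_nf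
    simp only [e]
    rw [integral_const_mul, ← exp_neg_softmin hc hB hβ W.continuous, ← Real.exp_add, h1]
    ring_nf
  -- Integrating first against `α` gives total mass 1, first against `β` gives `exp (-s)`.
  have hs0 : s = 0 := by
    have hint : Integrable (fun p : X × X => Real.exp (V p.1 + W p.2 - c p.1 p.2))
        ((α : Measure X).prod (β : Measure X)) := by
      refine integrable_of_continuous (hB.prod hB) ?_ (by fun_prop)
      rw [compl_prod_eq_union]
      refine measure_union_null ?_ ?_
      · rw [Measure.prod_prod, show (α : Measure X) Bᶜ = 0 from hα, zero_mul]
      · rw [Measure.prod_prod, show (β : Measure X) Bᶜ = 0 from hβ, mul_zero]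
    have := integral_integral_swap (f := fun x y => Real.exp (V x + W y - c x y)) hint
    simp only [hleft, hright] at this
    simpa using this
  refine ⟨V, W, ⟨V.continuous, W.continuous, fun x => by rw [h1, hs0, add_zero], fun y => rfl⟩,
    hV0⟩

open Classical in
/-- The first Schrödinger potential, normalized at `x₀`. -/
def leftPotential (c : X → X → ℝ) (x₀ : X) (α β : ProbabilityMeasure X) : C(X, ℝ) :=
  if h : ∃ f g : C(X, ℝ), IsSchrodingerPair c (α : Measure X) (β : Measure X) f g ∧ f x₀ = 0
  then h.choose else 0

open Classical in
/-- The second Schrödinger potential, when the first one is normalized at `x₀`. -/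
def rightPotential (c : X → X → ℝ) (x₀ : X) (α β : ProbabilityMeasure X) : C(X, ℝ) :=
  if h : ∃ f g : C(X, ℝ), IsSchrodingerPair c (α : Measure X) (β : Measure X) f g ∧ f x₀ = 0
  then h.choose_spec.choose else 0

theorem potential_spec (hc : Continuous fun p : X × X => c p.1 p.2)
    (hsymm : ∀ x y, c x y = c y x) (hB : IsCompact B) {α β : ProbabilityMeasure X}
    (hα : α ∈ carriedBy B) (hβ : β ∈ carriedBy B) (x₀ : X) :
    IsSchrodingerPair c (α : Measure X) (β : Measure X) (leftPotential c x₀ α β)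
      (rightPotential c x₀ α β) ∧ leftPotential c x₀ α β x₀ = 0 := by
  have h : ∃ f g : C(X, ℝ),
      IsSchrodingerPair c (α : Measure X) (β : Measure X) f g ∧ f x₀ = 0 := by
    obtain ⟨f, g, h, h0⟩ := exists_isSchrodingerPair hc hsymm hB hα hβ x₀
    exact ⟨⟨f, h.continuous_left⟩, ⟨g, h.continuous_right⟩, h, h0⟩
  rw [leftPotential, rightPotential, dif_pos h, dif_pos h]
  exact h.choose_spec.choose_spec

/-- The potentials at the limit point nearly solve the system of nearby measures: their residuals
are small on compact sets by joint continuity of the soft transform. Stability then bounds the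
distance between the potentials. -/
theorem continuousOn_leftPotential (hc : Continuous fun p : X × X => c p.1 p.2)
    (hsymm : ∀ x y, c x y = c y x) (hB : IsCompact B) (x₀ : X) :
    ContinuousOn (fun p : ProbabilityMeasure X × ProbabilityMeasure X =>
      leftPotential c x₀ p.1 p.2) (carriedBy B ×ˢ carriedBy B) := by
  rw [continuousOn_iff_continuous_domRestrict, continuous_iff_continuousAt]
  rintro ⟨⟨α₀, β₀⟩, hα₀, hβ₀⟩
  simp only at hα₀ hβ₀
  rw [ContinuousAt, ContinuousMap.tendsto_iff_forall_isCompact_tendstoUniformlyOn]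
  intro K hK
  obtain ⟨h₀, hz₀⟩ := potential_spec hc hsymm hB hα₀ hβ₀ x₀
  set f₀ := leftPotential c x₀ α₀ β₀
  set g₀ := rightPotential c x₀ α₀ β₀
  let P := ↥((carriedBy B : Set (ProbabilityMeasure X)) ×ˢ (carriedBy B))
  -- Both potentials vanish at `x₀`, so an oscillation bound on a set containing `x₀` and `K` is a
  -- uniform bound on `K`.
  have hB' : IsCompact (insert x₀ (B ∪ K)) := (hB.union hK).insert x₀
  have hBB' : B ⊆ insert x₀ (B ∪ K) := subset_union_left.trans (subset_insert _ _)
  obtain ⟨M, hM⟩ := exists_abs_le_of_isCompact hc hB'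
  have key : ∀ η > (0 : ℝ), ∀ (π : P → ↥(carriedBy (X := X) B)), Continuous π → ∀ f : C(X, ℝ),
      ∀ᶠ p : P in 𝓝 ⟨(α₀, β₀), hα₀, hβ₀⟩, ∀ x ∈ insert x₀ (B ∪ K),
        |softmin c (π p : ProbabilityMeasure X) f x -
          softmin c (π ⟨(α₀, β₀), hα₀, hβ₀⟩ : ProbabilityMeasure X) f x| < η := by
    intro η hη π hπ f
    have h1 : Continuous fun p : P => softminMap hc hB (π p, f) :=
      (softminMap hc hB).continuous.comp (by fun_prop)
    have h2 := (ContinuousMap.tendsto_iff_forall_isCompact_tendstoUniformlyOn.1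
      (h1.tendsto ⟨(α₀, β₀), hα₀, hβ₀⟩)) _ hB'
    filter_upwards [Metric.tendstoUniformlyOn_iff.1 h2 η hη] with p hp x hx
    have := hp x hx
    rwa [dist_comm, Real.dist_eq] at this
  rw [Metric.tendstoUniformlyOn_iff]
  intro δ hδ
  -- Each residual oscillates by at most `2 * η`, so stability yields `4 * η / exp (-4M) = 4δ/5 <
  -- δ`.
  set η := δ / 5 * Real.exp (-4 * M) with hη
  have hη0 : 0 < η := by positivity
  filter_upwards [key η hη0 (fun p => ⟨p.1.1, p.2.1⟩) (by fun_prop) f₀,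
    key η hη0 (fun p => ⟨p.1.2, p.2.2⟩) (by fun_prop) g₀] with p h₁ h₂ x hx
  obtain ⟨h, hz⟩ := potential_spec hc hsymm hB p.2.1 p.2.2 x₀
  have hst := h.stability h₀ hc hB' (carriedBy_mono hBB' p.2.1) (carriedBy_mono hBB' p.2.2) hM
    (D₁ := 2 * η) (D₂ := 2 * η) (fun x hx x' hx' => by
      have a1 := abs_lt.1 (h₁ x hx)
      have a2 := abs_lt.1 (h₁ x' hx')
      simp only [h₀.right] at a1 a2
      linarith) (fun x hx x' hx' => by
      have a1 := abs_lt.1 (h₂ x hx)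
      have a2 := abs_lt.1 (h₂ x' hx')
      simp only [h₀.left] at a1 a2
      linarith)
  have hxm : x ∈ insert x₀ (B ∪ K) := Or.inr (Or.inr hx)
  have b1 := hst x hxm x₀ (mem_insert _ _)
  have b2 := hst x₀ (mem_insert _ _) x hxm
  have e : (2 * η + 2 * η) / Real.exp (-4 * M) = 4 / 5 * δ := by
    rw [hη]; field_simp; ring
  rw [e, hz, hz₀] at b1 b2
  rw [dist_comm, Real.dist_eq]
  change |leftPotential c x₀ p.1.1 p.1.2 x - f₀ x| < δ
  rw [abs_lt]
  constructor <;> linarith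

theorem continuousOn_rightPotential (hc : Continuous fun p : X × X => c p.1 p.2)
    (hsymm : ∀ x y, c x y = c y x) (hB : IsCompact B) (x₀ : X) :
    ContinuousOn (fun p : ProbabilityMeasure X × ProbabilityMeasure X =>
      rightPotential c x₀ p.1 p.2) (carriedBy B ×ˢ carriedBy B) := by
  have h := continuousOn_leftPotential hc hsymm hB x₀
  rw [continuousOn_iff_continuous_domRestrict] at h ⊢
  have : Continuous fun p : ↥((carriedBy B : Set (ProbabilityMeasure X)) ×ˢ (carriedBy B)) =>
      softminMap hc hB (⟨p.1.1, p.2.1⟩, leftPotential c x₀ p.1.1 p.1.2) :=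
    (softminMap hc hB).continuous.comp ((by fun_prop : Continuous _).prodMk h)
  refine this.congr fun p => ?_
  ext y
  exact (potential_spec hc hsymm hB p.2.1 p.2.2 x₀).1.right y

end Potentials

/-! ### Entropic duality -/

section Duality

theorem map_fst_withDensity_prod {X : Type*} [MeasurableSpace X] {α β : Measure X} [SFinite α]
    [SFinite β] {w : X × X → ENNReal} (hw : Measurable w) (h : ∀ x, ∫⁻ y, w (x, y) ∂β = 1) :
    ((α.prod β).withDensity w).map Prod.fst = α := by
  ext s hs
  rw [Measure.map_apply measurable_fst hs, withDensity_apply _ (measurable_fst hs),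
    ← prod_univ, ← Measure.prod_restrict, lintegral_prod _ hw.aemeasurable]
  simp [h]

theorem map_snd_withDensity_prod {X : Type*} [MeasurableSpace X] {α β : Measure X} [SFinite α]
    [SFinite β] {w : X × X → ENNReal} (hw : Measurable w) (h : ∀ y, ∫⁻ x, w (x, y) ∂α = 1) :
    ((α.prod β).withDensity w).map Prod.snd = β := by
  ext s hs
  rw [Measure.map_apply measurable_snd hs, withDensity_apply _ (measurable_snd hs),
    ← univ_prod, ← Measure.prod_restrict, lintegral_prod_symm _ hw.aemeasurable]
  simp [h]

theorem prod_compl_eq_zero {X : Type*} [MeasurableSpace X] {B : Set X} {α β : Measure X}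
    [SFinite α] [SFinite β] (hα : α Bᶜ = 0) (hβ : β Bᶜ = 0) : (α.prod β) (B ×ˢ B)ᶜ = 0 := by
  rw [compl_prod_eq_union]
  refine measure_union_null ?_ ?_
  · rw [Measure.prod_prod, hα, zero_mul]
  · rw [Measure.prod_prod, hβ, mul_zero]

variable {X : Type*} [MeasurableSpace X] {B : Set X} {α β : ProbabilityMeasure X}
  {π : Measure (X × X)}

theorem isProbabilityMeasure_of_mem_couplings (hπ : π ∈ couplings α β) :
    IsProbabilityMeasure π := by
  have : IsProbabilityMeasure (π.map Prod.fst) := by rw [hπ.1]; infer_instance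
  exact ⟨by
    have h := this.measure_univ
    rwa [Measure.map_apply measurable_fst MeasurableSet.univ, preimage_univ] at h⟩

theorem coupling_compl_eq_zero (hBm : MeasurableSet B) (hα : α ∈ carriedBy B)
    (hβ : β ∈ carriedBy B) (h₁ : π.map Prod.fst = (α : Measure X))
    (h₂ : π.map Prod.snd = (β : Measure X)) : π (B ×ˢ B)ᶜ = 0 := by
  have e : (B ×ˢ B)ᶜ = Prod.fst ⁻¹' Bᶜ ∪ Prod.snd ⁻¹' Bᶜ := by
    rw [compl_prod_eq_union, prod_univ, univ_prod]
  rw [e]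
  refine measure_union_null ?_ ?_
  · rw [← Measure.map_apply measurable_fst hBm.compl, h₁]; exact hα
  · rw [← Measure.map_apply measurable_snd hBm.compl, h₂]; exact hβ

variable [TopologicalSpace X] [T2Space X] [BorelSpace X] [SecondCountableTopology X]
  {C : X → X → ℝ} {ε : ℝ} {f g : X → ℝ}

theorem integral_coupling (hC : Continuous fun p : X × X => C p.1 p.2) (hB : IsCompact B)
    (hα : α ∈ carriedBy B) (hβ : β ∈ carriedBy B) [IsFiniteMeasure π]
    (h₁ : π.map Prod.fst = (α : Measure X)) (h₂ : π.map Prod.snd = (β : Measure X))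
    (hf : Continuous f) (hg : Continuous g) :
    ∫ p, (f p.1 + g p.2 - C p.1 p.2 / ε) ∂π =
      ∫ x, f x ∂(α : Measure X) + ∫ y, g y ∂(β : Measure X) - (∫ p, C p.1 p.2 ∂π) / ε := by
  have hz := coupling_compl_eq_zero hB.measurableSet hα hβ h₁ h₂
  have hi : ∀ {φ : X × X → ℝ}, Continuous φ → Integrable φ π := fun hφ =>
    integrable_of_continuous (hB.prod hB) hz hφ
  rw [integral_sub (hi (by fun_prop)) (hi (by fun_prop)), integral_add (hi (by fun_prop))
    (hi (by fun_prop)), integral_div, ← h₁, ← h₂,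
    integral_map measurable_fst.aemeasurable hf.aestronglyMeasurable,
    integral_map measurable_snd.aemeasurable hg.aestronglyMeasurable]

/-- Weak duality. -/
theorem dual_le_cost (hC : Continuous fun p : X × X => C p.1 p.2) (hε : 0 < ε)
    (hB : IsCompact B) (hα : α ∈ carriedBy B) (hβ : β ∈ carriedBy B) (hπ : π ∈ couplings α β)
    (hf : Continuous f) (hg : Continuous g) :
    ε * (∫ x, f x ∂(α : Measure X) + ∫ y, g y ∂(β : Measure X) -
      Real.log (∫ p, Real.exp (f p.1 + g p.2 - C p.1 p.2 / ε)
        ∂((α : Measure X).prod (β : Measure X)))) ≤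
    ∫ p, C p.1 p.2 ∂π +
      ε * (InformationTheory.klDiv π ((α : Measure X).prod (β : Measure X))).toReal := by
  have := isProbabilityMeasure_of_mem_couplings hπ
  obtain ⟨hac, hint⟩ := InformationTheory.klDiv_ne_top_iff.1 hπ.2.2
  set ρ := (α : Measure X).prod (β : Measure X) with hρ
  have hcont : Continuous fun p : X × X => f p.1 + g p.2 - C p.1 p.2 / ε := by fun_prop
  have hz := coupling_compl_eq_zero hB.measurableSet hα hβ hπ.1 hπ.2.1
  have hexp : Integrable (fun p : X × X => Real.exp (f p.1 + g p.2 - C p.1 p.2 / ε)) ρ :=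
    integrable_of_continuous (hB.prod hB) (prod_compl_eq_zero hα hβ) (by fun_prop)
  have hh := integrable_of_continuous (hB.prod hB) hz hcont
  have key := integral_llr_tilted_right hac hh hexp hint
  have := isProbabilityMeasure_tilted hexp
  -- Gibbs' variational principle: the entropy of `π` relative to the tilted measure is nonnegative,
  -- and expanding it gives the dual inequality.
  have nn := InformationTheory.integral_llr_add_sub_measure_univ_nonneg
    (hac.trans (absolutelyContinuous_tilted hexp))
    (integrable_llr_tilted_right hac hh hint hexp)
  rw [key, integral_coupling hC hB hα hβ hπ.1 hπ.2.1 hf hg] at nn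
  simp only [probReal_univ] at nn
  rw [InformationTheory.toReal_klDiv_of_measure_eq hac (by simp)]
  have e : ∫ p, C p.1 p.2 ∂π = ε * ((∫ p, C p.1 p.2 ∂π) / ε) := by field_simp
  rw [e, ← mul_add]
  refine mul_le_mul_of_nonneg_left ?_ hε.le
  linarith

theorem IsSchrodingerPair.integral_prod {c : X → X → ℝ}
    (h : IsSchrodingerPair c (α : Measure X) (β : Measure X) f g)
    (hc : Continuous fun p : X × X => c p.1 p.2) (hB : IsCompact B) (hα : α ∈ carriedBy B)
    (hβ : β ∈ carriedBy B) : ∫ p, Real.exp (f p.1 + g p.2 - c p.1 p.2)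
      ∂((α : Measure X).prod (β : Measure X)) = 1 := by
  have hf := h.continuous_left
  have hg := h.continuous_right
  rw [MeasureTheory.integral_prod _ (integrable_of_continuous (hB.prod hB)
    (prod_compl_eq_zero hα hβ) (by fun_prop))]
  simp [h.integral_right hc hB hβ]

/-- The optimal coupling given by a solution of the Schrödinger system. -/
theorem IsSchrodingerPair.exists_coupling
    (h : IsSchrodingerPair (fun x y => C x y / ε) (α : Measure X) (β : Measure X) f g)
    (hC : Continuous fun p : X × X => C p.1 p.2) (hsymm : ∀ x y, C x y = C y x) (hε : 0 < ε)
    (hB : IsCompact B) (hα : α ∈ carriedBy B) (hβ : β ∈ carriedBy B) :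
    ∃ π ∈ couplings α β, ∫ p, C p.1 p.2 ∂π +
      ε * (InformationTheory.klDiv π ((α : Measure X).prod (β : Measure X))).toReal =
      ε * (∫ x, f x ∂(α : Measure X) + ∫ y, g y ∂(β : Measure X)) := by
  have hc : Continuous fun p : X × X => C p.1 p.2 / ε := by fun_prop
  have hs : ∀ x y, C x y / ε = C y x / ε := fun x y => by rw [hsymm]
  have hf := h.continuous_left
  have hg := h.continuous_right
  set ρ := (α : Measure X).prod (β : Measure X) with hρ
  set φ : X × X → ℝ := fun p => f p.1 + g p.2 - C p.1 p.2 / ε with hφ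
  have hcont : Continuous φ := by fun_prop
  have hone : ∫ p, Real.exp (φ p) ∂ρ = 1 := h.integral_prod hc hB hα hβ
  have hexp : Integrable (fun p => Real.exp (φ p)) ρ :=
    integrable_of_continuous (hB.prod hB) (prod_compl_eq_zero hα hβ) (by fun_prop)
  have := isProbabilityMeasure_tilted hexp
  have hw : Measurable fun p : X × X => ENNReal.ofReal (Real.exp (φ p) / 1) := by
    have := hcont.measurable
    fun_prop
  -- The normalizing constant is 1, so the density is exactly `exp φ` and the two Schrödinger
  -- equations are the two marginal conditions.
  have htilt : ρ.tilted φ = ρ.withDensity fun p => ENNReal.ofReal (Real.exp (φ p) / 1) := by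
    rw [Measure.tilted, hone]
  have h₁ : (ρ.tilted φ).map Prod.fst = (α : Measure X) := by
    rw [htilt]
    refine map_fst_withDensity_prod hw fun x => ?_
    simp only [div_one]
    rw [← ofReal_integral_eq_lintegral_ofReal (integrable_of_continuous hB hβ (by fun_prop))
      (Eventually.of_forall fun y => (Real.exp_pos _).le)]
    simp only [hφ]
    rw [h.integral_right hc hB hβ x, ENNReal.ofReal_one]
  have h₂ : (ρ.tilted φ).map Prod.snd = (β : Measure X) := by
    rw [htilt]
    refine map_snd_withDensity_prod hw fun y => ?_
    simp only [div_one]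
    rw [← ofReal_integral_eq_lintegral_ofReal (integrable_of_continuous hB hα (by fun_prop))
      (Eventually.of_forall fun y => (Real.exp_pos _).le)]
    simp only [hφ]
    rw [h.integral_left hc hs hB hα y, ENNReal.ofReal_one]
  have hz := coupling_compl_eq_zero hB.measurableSet hα hβ h₁ h₂
  have hac := tilted_absolutelyContinuous ρ φ
  have hllr : llr (ρ.tilted φ) ρ =ᵐ[ρ.tilted φ] φ := by
    refine hac.ae_le ((log_rnDeriv_tilted_left_self hexp).trans ?_)
    simp [hone]
  have hint : Integrable (llr (ρ.tilted φ) ρ) (ρ.tilted φ) :=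
    (integrable_of_continuous (hB.prod hB) hz hcont).congr hllr.symm
  refine ⟨ρ.tilted φ, ⟨h₁, h₂, InformationTheory.klDiv_ne_top hac hint⟩, ?_⟩
  rw [InformationTheory.toReal_klDiv_of_measure_eq hac (by simp), integral_congr_ae hllr,
    integral_coupling hC hB hα hβ h₁ h₂ hf hg]
  field_simp
  ring

/-- The entropic transport cost in terms of a solution of the Schrödinger system. -/
theorem IsSchrodingerPair.OT_eq
    (h : IsSchrodingerPair (fun x y => C x y / ε) (α : Measure X) (β : Measure X) f g)
    (hC : Continuous fun p : X × X => C p.1 p.2) (hsymm : ∀ x y, C x y = C y x) (hε : 0 < ε)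
    (hB : IsCompact B) (hα : α ∈ carriedBy B) (hβ : β ∈ carriedBy B) :
    OT C ε α β = ε * (∫ x, f x ∂(α : Measure X) + ∫ y, g y ∂(β : Measure X)) := by
  refine IsLeast.csInf_eq ⟨h.exists_coupling hC hsymm hε hB hα hβ, ?_⟩
  rintro _ ⟨π, hπ, rfl⟩
  have := dual_le_cost hC hε hB hα hβ hπ h.continuous_left h.continuous_right
  rwa [h.integral_prod (c := fun x y => C x y / ε) (by fun_prop) hB hα hβ, Real.log_one,
    sub_zero] at this

/-- Bounding `log z` by `z - 1` makes the penalty linear in the product measure. This suits test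
functions that are potentials of other measures. -/
theorem dual_le_OT (hC : Continuous fun p : X × X => C p.1 p.2)
    (hsymm : ∀ x y, C x y = C y x) (hε : 0 < ε) (hB : IsCompact B) (hα : α ∈ carriedBy B)
    (hβ : β ∈ carriedBy B) (hf : Continuous f) (hg : Continuous g) :
    ε * (∫ x, f x ∂(α : Measure X) + ∫ y, g y ∂(β : Measure X) -
      (∫ p, Real.exp (f p.1 + g p.2 - C p.1 p.2 / ε)
        ∂((α : Measure X).prod (β : Measure X)) - 1)) ≤ OT C ε α β := by
  obtain ⟨x₀⟩ : Nonempty X := (α : Measure X).nonempty_of_neZero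
  obtain ⟨a, b, hab, -⟩ := exists_isSchrodingerPair (c := fun x y => C x y / ε) (by fun_prop)
    (fun x y => by simp only [hsymm x y]) hB hα hβ x₀
  -- A lower bound passes to the real `sInf` only if the set of costs is nonempty.
  obtain ⟨π, hπ, -⟩ := hab.exists_coupling hC hsymm hε hB hα hβ
  refine le_csInf (Set.Nonempty.image _ ⟨π, hπ⟩) ?_
  rintro _ ⟨π, hπ, rfl⟩
  refine le_trans (mul_le_mul_of_nonneg_left ?_ hε.le) (dual_le_cost hC hε hB hα hβ hπ hf hg)
  have hexp : Integrable (fun p : X × X => Real.exp (f p.1 + g p.2 - C p.1 p.2 / ε))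
      ((α : Measure X).prod (β : Measure X)) :=
    integrable_of_continuous (hB.prod hB) (prod_compl_eq_zero hα hβ) (by fun_prop)
  linarith [Real.log_le_sub_one_of_pos (integral_exp_pos hexp)]

end Duality

/-! ### Energies and exponential densities -/

section Energy

variable {X : Type*} [MeasurableSpace X]

/-- The mutual energy `∬ k(x, y) dμ(x) dν(y)` of two measures. -/
def energy (k : X → X → ℝ) (μ ν : Measure X) : ℝ :=
  ∫ x, ∫ y, k x y ∂ν ∂μ

/-- The energy of differences of compactly carried finite measures is positive definite. -/
def IsPositiveDefinite [TopologicalSpace X] (k : X → X → ℝ) : Prop :=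
  ∀ B : Set X, IsCompact B → ∀ μ ν : Measure X, IsFiniteMeasure μ → IsFiniteMeasure ν →
    μ Bᶜ = 0 → ν Bᶜ = 0 → 0 ≤ energy k μ μ + energy k ν ν - 2 * energy k μ ν ∧
      (energy k μ μ + energy k ν ν - 2 * energy k μ ν = 0 → μ = ν)

variable [TopologicalSpace X] [BorelSpace X]

/-- The measure `exp(p) α`. -/
def expDensity (α : Measure X) (p : X → ℝ) : Measure X :=
  α.withDensity fun x => ENNReal.ofReal (Real.exp (p x))

theorem integral_expDensity (α : Measure X) {p : X → ℝ} (hp : Continuous p) (φ : X → ℝ) :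
    ∫ x, φ x ∂(expDensity α p) = ∫ x, Real.exp (p x) * φ x ∂α := by
  have hm := hp.measurable
  rw [expDensity, integral_withDensity_eq_integral_toReal_smul (by fun_prop) (by simp)]
  simp [ENNReal.toReal_ofReal (Real.exp_pos _).le]

theorem expDensity_injective {α α' : Measure X} {p : X → ℝ} (hp : Continuous p)
    (h : expDensity α p = expDensity α' p) : α = α' := by
  have hm := hp.measurable
  have key : ∀ μ : Measure X, (expDensity μ p).withDensity
      (fun x => ENNReal.ofReal (Real.exp (p x)))⁻¹ = μ := fun μ =>
    withDensity_inv_same (by fun_prop) (Eventually.of_forall fun x => by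
      simp [Real.exp_pos]) (Eventually.of_forall fun x => ENNReal.ofReal_ne_top)
  rw [← key α, h, key]

theorem isFiniteMeasure_expDensity [T2Space X] {B : Set X} {α : Measure X} [IsFiniteMeasure α] (hB : IsCompact B)
    (hα : α Bᶜ = 0) {p : X → ℝ} (hp : Continuous p) : IsFiniteMeasure (expDensity α p) :=
  isFiniteMeasure_withDensity_ofReal
    (integrable_of_continuous hB hα (by fun_prop : Continuous fun x => Real.exp (p x))).2

end Energy

/-! ### Symmetric potentials and definiteness of the divergence -/

section SymmetricPotential

variable {X : Type*} [MeasurableSpace X] [TopologicalSpace X]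

/-- The symmetric Schrödinger potential of a measure with itself. -/
def symmPotential (c : X → X → ℝ) (x₀ : X) (α : ProbabilityMeasure X) : C(X, ℝ) :=
  (1 / 2 : ℝ) • (leftPotential c x₀ α α + rightPotential c x₀ α α)

variable [T2Space X] [BorelSpace X] {B : Set X} {c C : X → X → ℝ} {ε : ℝ}
  {α α' β : ProbabilityMeasure X}

/-- Comparison of the symmetric potentials `p`, `p'` of two measures `α`, `α'`, from the energy of
`exp(p) α - exp(p') α'`. -/
theorem integral_exp_sub_symmPotential {p p' : X → ℝ}
    (hC : Continuous fun q : X × X => C q.1 q.2)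
    (hk : IsPositiveDefinite (gibbsKernel C ε)) (hB : IsCompact B)
    (hα : α ∈ carriedBy B) (hα' : α' ∈ carriedBy B)
    (h : IsSchrodingerPair (fun x y => C x y / ε) (α : Measure X) (α : Measure X) p p)
    (h' : IsSchrodingerPair (fun x y => C x y / ε) (α' : Measure X) (α' : Measure X) p' p') :
    ∫ x, Real.exp (p' x - p x) ∂(α' : Measure X) ≤ 1 ∧
      (∫ x, Real.exp (p' x - p x) ∂(α' : Measure X) = 1 → α' = α) := by
  have hp := h.continuous_left
  have hp' := h'.continuous_left
  have hc : Continuous fun q : X × X => C q.1 q.2 / ε := by fun_prop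
  -- This is the symmetric Schrödinger equation read as a potential: `k` integrated against `exp(q)
  -- γ` equals `exp (-q)`.
  have inner : ∀ {γ : ProbabilityMeasure X} {q : X → ℝ}, γ ∈ carriedBy B →
      IsSchrodingerPair (fun x y => C x y / ε) (γ : Measure X) (γ : Measure X) q q → ∀ x,
      ∫ y, gibbsKernel C ε x y ∂(expDensity (γ : Measure X) q) = Real.exp (-q x) := by
    intro γ q hγ hq x
    rw [integral_expDensity _ hq.continuous_left, ← hq.left,
      exp_neg_softmin hc hB hγ hq.continuous_left]
    refine integral_congr_ae (Eventually.of_forall fun y => ?_)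
    simp only [gibbsKernel]
    rw [← Real.exp_add]
    ring_nf
  have en : ∀ {γ γ' : ProbabilityMeasure X} {q q' : X → ℝ}, γ ∈ carriedBy B →
      IsSchrodingerPair (fun x y => C x y / ε) (γ : Measure X) (γ : Measure X) q q →
      Continuous q' → energy (gibbsKernel C ε) (expDensity (γ' : Measure X) q')
        (expDensity (γ : Measure X) q) =
      ∫ x, Real.exp (q' x - q x) ∂(γ' : Measure X) := by
    intro γ γ' q q' hγ hq hq'
    simp only [energy, inner hγ hq]
    rw [integral_expDensity _ hq']
    refine integral_congr_ae (Eventually.of_forall fun y => ?_)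
    simp only
    rw [← Real.exp_add, sub_eq_add_neg]
  have hz : ∀ {γ : ProbabilityMeasure X} {q : X → ℝ}, γ ∈ carriedBy B →
      expDensity (γ : Measure X) q Bᶜ = 0 := fun hγ =>
    withDensity_absolutelyContinuous _ _ hγ
  obtain ⟨h1, h2⟩ := hk B hB (expDensity (α' : Measure X) p') (expDensity (α : Measure X) p)
    (isFiniteMeasure_expDensity hB hα' hp') (isFiniteMeasure_expDensity hB hα hp)
    (hz hα') (hz hα)
  rw [en hα' h' hp', en hα h hp, en hα h hp'] at h1 h2
  simp only [sub_self, Real.exp_zero, integral_const, probReal_univ, smul_eq_mul, mul_one]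
    at h1 h2
  refine ⟨by linarith, fun he => ?_⟩
  have hd := h2 (by rw [he]; ring)
  -- Equal measures have equal `k`-potentials, so `exp (-p') = exp (-p)` everywhere; the common
  -- positive density can then be cancelled.
  have hpp : p' = p := by
    ext x
    have e1 := inner hα' h' x
    rw [hd, inner hα h x] at e1
    linarith [Real.exp_injective e1]
  rw [hpp] at hd
  exact Subtype.ext (expDensity_injective hp hd)

variable [SecondCountableTopology X]

/-- Exchanging `f` and `g` gives another solution for `(α, α)`, so `g - f` is a constant `s` by
uniqueness. The average `f + s / 2` is then fixed by the transform. -/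
theorem isSchrodingerPair_symmPotential (hc : Continuous fun p : X × X => c p.1 p.2)
    (hsymm : ∀ x y, c x y = c y x) (hB : IsCompact B) (hα : α ∈ carriedBy B) (x₀ : X) :
    IsSchrodingerPair c (α : Measure X) (α : Measure X) (symmPotential c x₀ α)
      (symmPotential c x₀ α) := by
  obtain ⟨h, -⟩ := potential_spec hc hsymm hB hα hα x₀
  set f := leftPotential c x₀ α α
  set g := rightPotential c x₀ α α
  set s := g x₀ - f x₀ with hs
  have hgf : ∀ x, g x = f x + s := fun x => by
    linarith [h.swap.unique h hc hB hα hα x x₀]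
  have hp : ∀ x, symmPotential c x₀ α x = f x + s / 2 := fun x => by
    change (1 / 2 : ℝ) * (f x + g x) = _
    rw [hgf]; ring
  have hT : ∀ x, softmin c (α : Measure X) (symmPotential c x₀ α) x =
      symmPotential c x₀ α x := fun x => by
    have e : (symmPotential c x₀ α : X → ℝ) = fun x => f x + s / 2 := funext hp
    rw [e, softmin_add_const hc hB hα f.continuous, h.right, hgf]
    ring
  exact ⟨(symmPotential c x₀ α).continuous, (symmPotential c x₀ α).continuous, hT, hT⟩

theorem OT_self_eq (hC : Continuous fun p : X × X => C p.1 p.2)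
    (hsymm : ∀ x y, C x y = C y x) (hε : 0 < ε) (hB : IsCompact B) (hα : α ∈ carriedBy B)
    {p : X → ℝ}
    (h : IsSchrodingerPair (fun x y => C x y / ε) (α : Measure X) (α : Measure X) p p) :
    OT C ε α α = 2 * (ε * ∫ x, p x ∂(α : Measure X)) := by
  rw [h.OT_eq hC hsymm hε hB hα hα]; ring

theorem OT_comm (hC : Continuous fun p : X × X => C p.1 p.2)
    (hsymm : ∀ x y, C x y = C y x) (hε : 0 < ε) (hB : IsCompact B) (hα : α ∈ carriedBy B)
    (hβ : β ∈ carriedBy B) : OT C ε α β = OT C ε β α := by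
  obtain ⟨x₀⟩ : Nonempty X := (α : Measure X).nonempty_of_neZero
  obtain ⟨f, g, h, -⟩ := exists_isSchrodingerPair (c := fun x y => C x y / ε) (by fun_prop)
    (fun x y => by simp only [hsymm x y]) hB hα hβ x₀
  rw [h.OT_eq hC hsymm hε hB hα hβ, h.swap.OT_eq hC hsymm hε hB hβ hα, add_comm]

section Divergence

variable (hC : Continuous fun p : X × X => C p.1 p.2) (hsymm : ∀ x y, C x y = C y x)
  (hε : 0 < ε) (hB : IsCompact B)

include hC hsymm hε hB

theorem divergence_comm (hα : α ∈ carriedBy B) (hβ : β ∈ carriedBy B) :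
    divergence C ε α β = divergence C ε β α := by
  rw [divergence, divergence, OT_comm hC hsymm hε hB hα hβ]; ring

/-- The symmetric potentials `p` of `α` and `q` of `β` are test functions for the dual of `OT α β`.
Their integrals cancel the two self-costs and leave `ε (1 - ∫ exp (p - q) dα)`, which the energy
comparison controls. -/
theorem divergence_nonneg_and_eq (hk : IsPositiveDefinite (gibbsKernel C ε))
    (hα : α ∈ carriedBy B) (hβ : β ∈ carriedBy B) :
    0 ≤ divergence C ε α β ∧ (divergence C ε α β = 0 → α = β) := by
  obtain ⟨x₀⟩ : Nonempty X := (α : Measure X).nonempty_of_neZero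
  have hc : Continuous fun q : X × X => C q.1 q.2 / ε := by fun_prop
  have hs : ∀ x y, C x y / ε = C y x / ε := fun x y => by rw [hsymm]
  have ha := isSchrodingerPair_symmPotential hc hs hB hα x₀
  have hb := isSchrodingerPair_symmPotential hc hs hB hβ x₀
  set p := symmPotential (fun x y => C x y / ε) x₀ α
  set q := symmPotential (fun x y => C x y / ε) x₀ β
  obtain ⟨h1, h2⟩ := integral_exp_sub_symmPotential hC hk hB hβ hα hb ha
  have hd := dual_le_OT hC hsymm hε hB hα hβ p.continuous q.continuous
  have e : ∫ z, Real.exp (p z.1 + q z.2 - C z.1 z.2 / ε)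
      ∂((α : Measure X).prod (β : Measure X)) = ∫ x, Real.exp (p x - q x) ∂(α : Measure X) := by
    rw [MeasureTheory.integral_prod _ (integrable_of_continuous (hB.prod hB)
      (prod_compl_eq_zero hα hβ) (by fun_prop))]
    refine integral_congr_ae (Eventually.of_forall fun x => ?_)
    have e' : ∀ y, Real.exp (p x + q y - C x y / ε) =
      Real.exp (p x - q x) * Real.exp (q x + q y - C x y / ε) := fun y => by
      rw [← Real.exp_add]; ring_nf
    simp only [e']
    rw [integral_const_mul, hb.integral_right hc hB hβ, mul_one]
  rw [e] at hd
  have key : ε * (1 - ∫ x, Real.exp (p x - q x) ∂(α : Measure X)) ≤ divergence C ε α β := by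
    rw [divergence, OT_self_eq hC hsymm hε hB hα ha, OT_self_eq hC hsymm hε hB hβ hb]
    linarith
  refine ⟨(mul_nonneg hε.le (by linarith)).trans key, fun h0 => h2 (le_antisymm h1 ?_)⟩
  rw [h0] at key
  by_contra hlt
  push Not at hlt
  have := mul_pos hε (sub_pos.2 hlt)
  linarith

end Divergence

end SymmetricPotential

/-! ### Convexity -/

section Convexity

variable {X : Type*} [MeasurableSpace X] {B : Set X} {α α₀ α₁ β : ProbabilityMeasure X} {a b : ℝ}

theorem carriedBy_of_mixture (h₀ : α₀ ∈ carriedBy B) (h₁ : α₁ ∈ carriedBy B)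
    (h : (α : Measure X) = ENNReal.ofReal a • (α₀ : Measure X) +
      ENNReal.ofReal b • (α₁ : Measure X)) : α ∈ carriedBy B := by
  change (α : Measure X) Bᶜ = 0
  rw [h]
  simp [show (α₀ : Measure X) Bᶜ = 0 from h₀, show (α₁ : Measure X) Bᶜ = 0 from h₁]

theorem integral_mixture {φ : X → ℝ} (ha : 0 ≤ a) (hb : 0 ≤ b)
    (h : (α : Measure X) = ENNReal.ofReal a • (α₀ : Measure X) +
      ENNReal.ofReal b • (α₁ : Measure X)) (h₀ : Integrable φ (α₀ : Measure X))
    (h₁ : Integrable φ (α₁ : Measure X)) :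
    ∫ x, φ x ∂(α : Measure X) =
      a * ∫ x, φ x ∂(α₀ : Measure X) + b * ∫ x, φ x ∂(α₁ : Measure X) := by
  rw [h, integral_add_measure (h₀.smul_measure ENNReal.ofReal_ne_top)
    (h₁.smul_measure ENNReal.ofReal_ne_top), integral_smul_measure, integral_smul_measure,
    ENNReal.toReal_ofReal ha, ENNReal.toReal_ofReal hb, smul_eq_mul, smul_eq_mul]

variable [TopologicalSpace X] [T2Space X] [BorelSpace X] [SecondCountableTopology X]
  {C : X → X → ℝ} {ε : ℝ}

/-- With `(f, g)` the potentials of `(α, β)` and `p` the symmetric potential of the mixture `α`, the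
map `γ ↦ ε ∫ (f - p) dγ` plus a constant lies below `S γ β` and touches it at `γ = α`. Averaging
over `α₀` and `α₁` concludes. -/
theorem divergence_convex_left (hC : Continuous fun p : X × X => C p.1 p.2)
    (hsymm : ∀ x y, C x y = C y x) (hε : 0 < ε) (hk : IsPositiveDefinite (gibbsKernel C ε))
    (hB : IsCompact B) (h₀ : α₀ ∈ carriedBy B) (h₁ : α₁ ∈ carriedBy B) (hβ : β ∈ carriedBy B)
    (ha : 0 ≤ a) (hb : 0 ≤ b) (hab : a + b = 1)
    (h : (α : Measure X) = ENNReal.ofReal a • (α₀ : Measure X) +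
      ENNReal.ofReal b • (α₁ : Measure X)) :
    divergence C ε α β ≤ a * divergence C ε α₀ β + b * divergence C ε α₁ β := by
  obtain ⟨x₀⟩ : Nonempty X := (α : Measure X).nonempty_of_neZero
  have hc : Continuous fun q : X × X => C q.1 q.2 / ε := by fun_prop
  have hs : ∀ x y, C x y / ε = C y x / ε := fun x y => by rw [hsymm]
  have hα := carriedBy_of_mixture h₀ h₁ h
  have hmix : ∀ {φ : X → ℝ}, Continuous φ → ∫ x, φ x ∂(α : Measure X) =
      a * ∫ x, φ x ∂(α₀ : Measure X) + b * ∫ x, φ x ∂(α₁ : Measure X) := fun hφ =>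
    integral_mixture ha hb h (integrable_of_continuous hB h₀ hφ)
      (integrable_of_continuous hB h₁ hφ)
  obtain ⟨f, g, hfg, -⟩ := exists_isSchrodingerPair hc hs hB hα hβ x₀
  have hf := hfg.continuous_left
  have hg := hfg.continuous_right
  -- The equation in `y` holds at every `x`, so the Gibbs density has mass 1 against `γ ⊗ β` for any
  -- `γ`, and the dual penalty vanishes.
  have cross : ∀ γ : ProbabilityMeasure X, γ ∈ carriedBy B →
      ε * (∫ x, f x ∂(γ : Measure X) + ∫ y, g y ∂(β : Measure X)) ≤ OT C ε γ β := by
    intro γ hγ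
    have hd := dual_le_OT hC hsymm hε hB hγ hβ hf hg
    rwa [MeasureTheory.integral_prod _ (integrable_of_continuous (hB.prod hB)
      (prod_compl_eq_zero hγ hβ) (by fun_prop)), integral_congr_ae (Eventually.of_forall
      fun x => hfg.integral_right hc hB hβ x), integral_const, probReal_univ, one_smul,
      sub_self, sub_zero] at hd
  have hp := isSchrodingerPair_symmPotential hc hs hB hα x₀
  have hp₀ := isSchrodingerPair_symmPotential hc hs hB h₀ x₀
  have hp₁ := isSchrodingerPair_symmPotential hc hs hB h₁ x₀
  set p := symmPotential (fun x y => C x y / ε) x₀ α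
  set p₀ := symmPotential (fun x y => C x y / ε) x₀ α₀
  set p₁ := symmPotential (fun x y => C x y / ε) x₀ α₁
  -- From `1 + s ≤ exp s` and the energy comparison. It bounds the self-cost of `γ` by a function
  -- linear in `γ`, with equality at `α`.
  have comp : ∀ (γ : ProbabilityMeasure X) (q : C(X, ℝ)), γ ∈ carriedBy B →
      IsSchrodingerPair (fun x y => C x y / ε) (γ : Measure X) (γ : Measure X) q q →
      ∫ x, q x ∂(γ : Measure X) ≤ ∫ x, p x ∂(γ : Measure X) := by
    intro γ q hγ hq
    have h1 := (integral_exp_sub_symmPotential hC hk hB hα hγ hp hq).1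
    have i1 := integrable_of_continuous hB hγ q.continuous
    have i2 := integrable_of_continuous hB hγ p.continuous
    have h2 : ∫ x, (q x - p x + 1) ∂(γ : Measure X) ≤
        ∫ x, Real.exp (q x - p x) ∂(γ : Measure X) :=
      integral_mono ((i1.sub i2).add (integrable_const 1))
        (integrable_of_continuous hB hγ (by fun_prop)) fun x => Real.add_one_le_exp _
    rw [integral_add (f := fun x => q x - p x) (i1.sub i2) (integrable_const 1),
      integral_sub i1 i2, integral_const, probReal_univ, one_smul] at h2
    linarith
  have c₀ := cross α₀ h₀
  have c₁ := cross α₁ h₁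
  have d₀ := mul_le_mul_of_nonneg_left (comp α₀ p₀ h₀ hp₀) hε.le
  have d₁ := mul_le_mul_of_nonneg_left (comp α₁ p₁ h₁ hp₁) hε.le
  rw [divergence, divergence, divergence, hfg.OT_eq hC hsymm hε hB hα hβ,
    OT_self_eq hC hsymm hε hB hα hp, OT_self_eq hC hsymm hε hB h₀ hp₀,
    OT_self_eq hC hsymm hε hB h₁ hp₁, hmix hf, hmix p.continuous]
  set F₀ := ∫ x, f x ∂(α₀ : Measure X)
  set F₁ := ∫ x, f x ∂(α₁ : Measure X)
  set G := ∫ x, g x ∂(β : Measure X)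
  have hb' : b = 1 - a := by linarith
  have m1 := mul_le_mul_of_nonneg_left c₀ ha
  have m2 := mul_le_mul_of_nonneg_left c₁ hb
  have m3 := mul_le_mul_of_nonneg_left d₀ ha
  have m4 := mul_le_mul_of_nonneg_left d₁ hb
  have e : ε * (a * F₀ + b * F₁ + G) = a * (ε * (F₀ + G)) + b * (ε * (F₁ + G)) := by
    rw [hb']; ring
  have e2 : OT C ε β β / 2 = a * (OT C ε β β / 2) + b * (OT C ε β β / 2) := by
    rw [hb']; ring
  rw [e]
  linarith

end Convexity

/-! ### Weak continuity and metrization -/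

section Continuity

/-- By continuity each cluster point of `u` is a zero of `S`, hence equals `y`. In a compact set a
unique cluster point is a limit. -/
theorem tendsto_of_unique_zero {Y : Type*} [TopologicalSpace Y] {N : Set Y} (hN : IsCompact N)
    {S : Y → ℝ} (hS : ContinuousOn S N) {y : Y} (h0 : ∀ z ∈ N, S z = 0 → z = y) {u : ℕ → Y}
    (hu : ∀ n, u n ∈ N) (h : Tendsto (fun n => S (u n)) atTop (𝓝 0)) :
    Tendsto u atTop (𝓝 y) := by
  refine hN.tendsto_nhds_of_unique_mapClusterPt (Eventually.of_forall hu) fun z hz hcl => ?_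
  refine h0 z hz ?_
  have h1 : MapClusterPt (S z) atTop (fun n => S (u n)) := by
    refine hcl.tendsto_comp' ((hS z hz).tendsto.mono_left ?_)
    exact inf_le_inf_left _ (tendsto_principal.2 (Eventually.of_forall hu))
  have h2 : ClusterPt (S z) (𝓝 0) := ClusterPt.mono h1 h
  exact eq_of_nhds_neBot h2

variable {X : Type*} [MeasurableSpace X] [TopologicalSpace X] [T2Space X] [BorelSpace X]
  {B : Set X} {c C : X → X → ℝ} {ε : ℝ}

/-- Prokhorov's theorem, with a constant sequence of compact sets `B` and zero mass allowed outside.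
-/
theorem isCompact_carriedBy (hB : IsCompact B) :
    IsCompact (carriedBy B : Set (ProbabilityMeasure X)) := by
  have := isCompact_setOfPred_probabilityMeasure_mass_eq_compl_isCompact_le (u := fun _ => 0)
    (K := fun _ => B) tendsto_const_nhds (fun _ => hB) (Or.inr monotone_const)
  convert this using 1
  ext μ
  simp [carriedBy]

variable [SecondCountableTopology X]

theorem continuousOn_OT (hC : Continuous fun p : X × X => C p.1 p.2)
    (hsymm : ∀ x y, C x y = C y x) (hε : 0 < ε) (hB : IsCompact B) :
    ContinuousOn (fun p : ProbabilityMeasure X × ProbabilityMeasure X => OT C ε p.1 p.2)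
      (carriedBy B ×ˢ carriedBy B) := by
  rcases isEmpty_or_nonempty X with hX | ⟨⟨x₀⟩⟩
  · rintro ⟨α, -⟩
    exact isEmptyElim (α : Measure X).nonempty_of_neZero.some
  have hc : Continuous fun q : X × X => C q.1 q.2 / ε := by fun_prop
  have hs : ∀ x y, C x y / ε = C y x / ε := fun x y => by rw [hsymm]
  have h1 := continuousOn_leftPotential hc hs hB x₀
  have h2 := continuousOn_rightPotential hc hs hB x₀
  have i1 := (continuousOn_integral hB).comp (continuousOn_fst.prodMk h1)
    fun p hp => ⟨hp.1, mem_univ _⟩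
  have i2 := (continuousOn_integral hB).comp (continuousOn_snd.prodMk h2)
    fun p hp => ⟨hp.2, mem_univ _⟩
  refine ((i1.add i2).const_smul ε).congr fun p hp => ?_
  exact (potential_spec hc hs hB hp.1 hp.2 x₀).1.OT_eq hC hsymm hε hB hp.1 hp.2

theorem continuousOn_divergence (hC : Continuous fun p : X × X => C p.1 p.2)
    (hsymm : ∀ x y, C x y = C y x) (hε : 0 < ε) (hB : IsCompact B) :
    ContinuousOn (fun p : ProbabilityMeasure X × ProbabilityMeasure X =>
      divergence C ε p.1 p.2) (carriedBy B ×ˢ carriedBy B) := by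
  have h := continuousOn_OT hC hsymm hε hB
  have h1 : ContinuousOn (fun p : ProbabilityMeasure X × ProbabilityMeasure X => (p.1, p.1))
    (carriedBy B ×ˢ carriedBy B) := by fun_prop
  have h2 : ContinuousOn (fun p : ProbabilityMeasure X × ProbabilityMeasure X => (p.2, p.2))
    (carriedBy B ×ˢ carriedBy B) := by fun_prop
  exact (h.sub ((h.comp h1 fun p hp => ⟨hp.1, hp.1⟩).div_const 2)).sub
    ((h.comp h2 fun p hp => ⟨hp.2, hp.2⟩).div_const 2)

theorem continuousOn_symmPotential (hc : Continuous fun p : X × X => c p.1 p.2)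
    (hsymm : ∀ x y, c x y = c y x) (hB : IsCompact B) (x₀ : X) :
    ContinuousOn (symmPotential c x₀) (carriedBy B) := by
  have hd : ContinuousOn (fun α : ProbabilityMeasure X => (α, α)) (carriedBy B) :=
    continuousOn_id.prodMk continuousOn_id
  have h1 := (continuousOn_leftPotential hc hsymm hB x₀).comp hd fun _ hp => ⟨hp, hp⟩
  have h2 := (continuousOn_rightPotential hc hsymm hB x₀).comp hd fun _ hp => ⟨hp, hp⟩
  exact (h1.add h2).const_smul (1 / 2 : ℝ)

theorem divergence_metrizes (hC : Continuous fun p : X × X => C p.1 p.2)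
    (hsymm : ∀ x y, C x y = C y x) (hε : 0 < ε) (hk : IsPositiveDefinite (gibbsKernel C ε))
    (hB : IsCompact B) {α : ℕ → ProbabilityMeasure X} {α' : ProbabilityMeasure X}
    (hα : ∀ n, α n ∈ carriedBy B) (hα' : α' ∈ carriedBy B) :
    Tendsto α atTop (𝓝 α') ↔ Tendsto (fun n => divergence C ε (α n) α') atTop (𝓝 0) := by
  have hd : ContinuousOn (fun γ : ProbabilityMeasure X => (γ, α')) (carriedBy B) :=
    by fun_prop
  have hm : MapsTo (fun γ : ProbabilityMeasure X => (γ, α')) (carriedBy B)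
    (carriedBy B ×ˢ carriedBy B) := fun γ hp => ⟨hp, hα'⟩
  have hcont : ContinuousOn (fun γ => divergence C ε γ α') (carriedBy B) :=
    ((continuousOn_divergence hC hsymm hε hB).comp hd hm).congr fun _ _ => rfl
  have hself : divergence C ε α' α' = 0 := by rw [divergence]; ring
  constructor
  · intro h
    have := (hcont α' hα').tendsto.comp (tendsto_nhdsWithin_iff.2 ⟨h, Eventually.of_forall hα⟩)
    rwa [hself] at this
  · intro h
    exact tendsto_of_unique_zero (isCompact_carriedBy hB) hcont (fun γ hγ =>
      (divergence_nonneg_and_eq hC hsymm hε hB hk hγ hα').2) hα h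

end Continuity

/-! ### Displacements of measures -/

section Displacement

variable {X : Type*} [MeasurableSpace X] {α α' ρ ρ' : ProbabilityMeasure X} {t : ℝ}

theorem isDisplaced_iff : IsDisplaced α ρ ρ' t α' ↔ ∀ s : Set X, MeasurableSet s →
    (α' : Measure X).real s = (α : Measure X).real s +
      t * ((ρ : Measure X).real s - (ρ' : Measure X).real s) := by
  rw [IsDisplaced, VectorMeasure.ext_iff]
  refine forall₂_congr fun s hs => ?_
  simp [Measure.toSignedMeasure_apply_measurable hs]

theorem IsDisplaced.symm (h : IsDisplaced α ρ ρ' t α') : IsDisplaced α' ρ ρ' (-t) α :=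
  isDisplaced_iff.2 fun s hs => by rw [isDisplaced_iff.1 h s hs]; ring

theorem IsDisplaced.swap (h : IsDisplaced α ρ ρ' t α') : IsDisplaced α ρ' ρ (-t) α' :=
  isDisplaced_iff.2 fun s hs => by rw [isDisplaced_iff.1 h s hs]; ring

theorem IsDisplaced.mem_carriedBy {B : Set X} (h : IsDisplaced α ρ ρ' t α')
    (hB : MeasurableSet B) (hα : α ∈ carriedBy B) (hρ : ρ ∈ carriedBy B)
    (hρ' : ρ' ∈ carriedBy B) : α' ∈ carriedBy B := by
  have := isDisplaced_iff.1 h _ hB.compl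
  have e : ∀ {γ : ProbabilityMeasure X}, γ ∈ carriedBy B → (γ : Measure X).real Bᶜ = 0 :=
    fun hγ => by rw [measureReal_def, show (_ : Measure X) Bᶜ = 0 from hγ, ENNReal.toReal_zero]
  rw [e hα, e hρ, e hρ'] at this
  have h0 : (α' : Measure X).real Bᶜ = 0 := by linarith
  exact (measureReal_eq_zero_iff).1 h0

theorem IsDisplaced.integral_eq (h : IsDisplaced α ρ ρ' t α') {φ : X → ℝ}
    (hα : Integrable φ (α : Measure X)) (hα' : Integrable φ (α' : Measure X))
    (hρ : Integrable φ (ρ : Measure X)) (hρ' : Integrable φ (ρ' : Measure X)) :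
    ∫ x, φ x ∂(α' : Measure X) = ∫ x, φ x ∂(α : Measure X) +
      t * (∫ x, φ x ∂(ρ : Measure X) - ∫ x, φ x ∂(ρ' : Measure X)) := by
  wlog ht : 0 ≤ t generalizing t ρ ρ'
  · rw [this h.swap hρ' hρ (by linarith)]
    ring
  -- Moving the negative part across turns the signed identity into one between positive measures,
  -- for which integrals add.
  have e : (α' : Measure X) + ENNReal.ofReal t • (ρ' : Measure X) =
      (α : Measure X) + ENNReal.ofReal t • (ρ : Measure X) := by
    ext s hs
    have := isDisplaced_iff.1 h s hs
    simp only [Measure.add_apply, Measure.smul_apply, smul_eq_mul]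
    rw [← ENNReal.toReal_eq_toReal_iff' (by finiteness) (by finiteness),
      ENNReal.toReal_add (by finiteness) (by finiteness),
      ENNReal.toReal_add (by finiteness) (by finiteness), ENNReal.toReal_mul, ENNReal.toReal_mul,
      ENNReal.toReal_ofReal ht]
    simp only [measureReal_def] at this
    linarith
  have : ∫ x, φ x ∂((α' : Measure X) + ENNReal.ofReal t • (ρ' : Measure X)) =
    ∫ x, φ x ∂((α : Measure X) + ENNReal.ofReal t • (ρ : Measure X)) := by rw [e]
  rw [integral_add_measure hα' (hρ'.smul_measure ENNReal.ofReal_ne_top),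
    integral_add_measure hα (hρ.smul_measure ENNReal.ofReal_ne_top), integral_smul_measure,
    integral_smul_measure, ENNReal.toReal_ofReal ht, smul_eq_mul, smul_eq_mul] at this
  linarith

theorem tendsto_of_isDisplaced [TopologicalSpace X] [OpensMeasurableSpace X] {ι : Type*}
    {l : Filter ι} {t : ι → ℝ} {a : ι → ProbabilityMeasure X} (ht : Tendsto t l (𝓝 0))
    (ha : ∀ᶠ i in l, IsDisplaced α ρ ρ' (t i) (a i)) : Tendsto a l (𝓝 α) := by
  rw [ProbabilityMeasure.tendsto_iff_forall_integral_tendsto]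
  intro φ
  have h1 : Tendsto (fun i => ∫ x, φ x ∂(α : Measure X) + t i * (∫ x, φ x ∂(ρ : Measure X) -
      ∫ x, φ x ∂(ρ' : Measure X))) l (𝓝 (∫ x, φ x ∂(α : Measure X))) := by
    simpa using (ht.mul_const (∫ x, φ x ∂(ρ : Measure X) -
      ∫ x, φ x ∂(ρ' : Measure X))).const_add (∫ x, φ x ∂(α : Measure X))
  refine h1.congr' (ha.mono fun i hi => ?_)
  exact (hi.integral_eq (φ.integrable _) (φ.integrable _) (φ.integrable _) (φ.integrable _)).symm

end Displacement

/-! ### First variation of the cost and of the divergence -/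

section Gradient

variable {X : Type*} [MeasurableSpace X] [TopologicalSpace X] [T2Space X] [BorelSpace X]
  {B : Set X} {c C : X → X → ℝ} {ε : ℝ} {α α' β β' ρ ρ' σ σ' : ProbabilityMeasure X} {t : ℝ}
  {f g : X → ℝ}

theorem continuous_integral_exp (hc : Continuous fun p : X × X => c p.1 p.2) (hB : IsCompact B)
    (hσ : σ ∈ carriedBy B) (hf : Continuous f) (hg : Continuous g) :
    Continuous fun x => ∫ y, Real.exp (f x + g y - c x y) ∂(σ : Measure X) := by
  have h : ∀ x, ∫ y, Real.exp (f x + g y - c x y) ∂(σ : Measure X) =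
      Real.exp (f x - softmin c (σ : Measure X) g x) := fun x => by
    have e : ∀ y, Real.exp (f x + g y - c x y) = Real.exp (f x) * Real.exp (g y - c x y) :=
      fun y => by rw [← Real.exp_add]; ring_nf
    simp only [e]
    rw [integral_const_mul, ← exp_neg_softmin hc hB hσ hg, ← Real.exp_add, sub_eq_add_neg]
  simp only [h]
  have := continuous_softmin hc hB hσ hg
  fun_prop

/-- The integral of the Gibbs density `exp (f ⊕ g - c)` against `ρ ⊗ σ`. -/
def gibbsMass (c : X → X → ℝ) (f g : X → ℝ) (ρ σ : ProbabilityMeasure X) : ℝ :=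
  ∫ p, Real.exp (f p.1 + g p.2 - c p.1 p.2) ∂((ρ : Measure X).prod (σ : Measure X))

/-- The second order variation of `gibbsMass` in the directions `ρ - ρ'` and `σ - σ'`. -/
def gibbsMassVariation (c : X → X → ℝ) (f g : X → ℝ) (ρ ρ' σ σ' : ProbabilityMeasure X) : ℝ :=
  (gibbsMass c f g ρ σ - gibbsMass c f g ρ σ') - (gibbsMass c f g ρ' σ - gibbsMass c f g ρ' σ')

variable [SecondCountableTopology X]

theorem continuous_gibbsMass (hc : Continuous fun p : X × X => c p.1 p.2) (hB : IsCompact B)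
    (hρ : ρ ∈ carriedBy B) (hσ : σ ∈ carriedBy B) :
    Continuous fun q : C(X, ℝ) × C(X, ℝ) => gibbsMass c q.1 q.2 ρ σ := by
  let m : ProbabilityMeasure (X × X) :=
    ⟨(ρ : Measure X).prod (σ : Measure X), inferInstance⟩
  let E : C(ℝ, ℝ) := ⟨Real.exp, Real.continuous_exp⟩
  let cc : C(X × X, ℝ) := ⟨fun p => c p.1 p.2, hc⟩
  have h1 : Continuous fun q : C(X, ℝ) × C(X, ℝ) =>
      (m, E.comp (q.1.comp ContinuousMap.fst + q.2.comp ContinuousMap.snd - cc)) := by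
    refine continuous_const.prodMk ((ContinuousMap.continuous_postcomp E).comp ?_)
    exact (((ContinuousMap.continuous_precomp _).comp continuous_fst).add
      ((ContinuousMap.continuous_precomp _).comp continuous_snd)).sub continuous_const
  exact (continuousOn_integral (hB.prod hB)).comp_continuous h1
    fun p => ⟨prod_compl_eq_zero hρ hσ, mem_univ _⟩

/-- The mass is bilinear in the two measures, and it equals 1 against `α ⊗ γ` and `γ ⊗ β` for every
`γ` carried by `B`. The first order terms are therefore multiples of `1 - 1`, and only the `t ^ 2`
term survives. -/
theorem IsSchrodingerPair.gibbsMass_displaced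
    (h : IsSchrodingerPair c (α : Measure X) (β : Measure X) f g)
    (hc : Continuous fun p : X × X => c p.1 p.2) (hsymm : ∀ x y, c x y = c y x)
    (hB : IsCompact B) (hα : α ∈ carriedBy B) (hβ : β ∈ carriedBy B) (hρ : ρ ∈ carriedBy B)
    (hρ' : ρ' ∈ carriedBy B) (hσ : σ ∈ carriedBy B) (hσ' : σ' ∈ carriedBy B)
    (hα' : IsDisplaced α ρ ρ' t α') (hβ' : IsDisplaced β σ σ' t β') :
    gibbsMass c f g α' β' = 1 + t ^ 2 * gibbsMassVariation c f g ρ ρ' σ σ' := by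
  have hf := h.continuous_left
  have hg := h.continuous_right
  have hαB := hα'.mem_carriedBy hB.measurableSet hα hρ hρ'
  have hβB := hβ'.mem_carriedBy hB.measurableSet hβ hσ hσ'
  have hi : ∀ {γ : ProbabilityMeasure X} {φ : X → ℝ}, γ ∈ carriedBy B → Continuous φ →
    Integrable φ (γ : Measure X) := fun hγ hφ => integrable_of_continuous hB hγ hφ
  have hip : ∀ {γ γ' : ProbabilityMeasure X}, γ ∈ carriedBy B → γ' ∈ carriedBy B →
      Integrable (fun p : X × X => Real.exp (f p.1 + g p.2 - c p.1 p.2))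
        ((γ : Measure X).prod (γ' : Measure X)) := fun hγ hγ' =>
    integrable_of_continuous (hB.prod hB) (prod_compl_eq_zero hγ hγ') (by fun_prop)
  have hmass : ∀ {γ γ' : ProbabilityMeasure X}, γ ∈ carriedBy B → γ' ∈ carriedBy B →
      gibbsMass c f g γ γ' = ∫ x, ∫ y, Real.exp (f x + g y - c x y) ∂(γ' : Measure X)
        ∂(γ : Measure X) := fun hγ hγ' => MeasureTheory.integral_prod _ (hip hγ hγ')
  have hα1 : ∀ {γ : ProbabilityMeasure X}, γ ∈ carriedBy B → gibbsMass c f g α γ = 1 := by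
    intro γ hγ
    rw [gibbsMass, MeasureTheory.integral_prod_symm _ (hip hα hγ)]
    simp [h.integral_left hc hsymm hB hα]
  set v : ProbabilityMeasure X → X → ℝ := fun γ x =>
    ∫ y, Real.exp (f x + g y - c x y) ∂(γ : Measure X) with hv
  have hvc : ∀ {γ : ProbabilityMeasure X}, γ ∈ carriedBy B → Continuous (v γ) := fun hγ =>
    continuous_integral_exp hc hB hγ hf hg
  have hinner : ∀ x, v β' x = 1 + t * (v σ x - v σ' x) := by
    intro x
    have hcx : Continuous fun y => Real.exp (f x + g y - c x y) := by fun_prop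
    have := hβ'.integral_eq (hi hβ hcx) (hi hβB hcx) (hi hσ hcx) (hi hσ' hcx)
    rwa [h.integral_right hc hB hβ] at this
  have hαs : ∫ x, v σ x ∂(α : Measure X) = 1 := by rw [← hα1 hσ, hmass hα hσ]
  have hαs' : ∫ x, v σ' x ∂(α : Measure X) = 1 := by rw [← hα1 hσ', hmass hα hσ']
  have e1 := hα'.integral_eq (hi hα (hvc hσ)) (hi hαB (hvc hσ)) (hi hρ (hvc hσ))
    (hi hρ' (hvc hσ))
  have e2 := hα'.integral_eq (hi hα (hvc hσ')) (hi hαB (hvc hσ')) (hi hρ (hvc hσ'))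
    (hi hρ' (hvc hσ'))
  have e3 : gibbsMass c f g α' β' =
      1 + t * (∫ x, v σ x ∂(α' : Measure X) - ∫ x, v σ' x ∂(α' : Measure X)) := by
    rw [hmass hαB hβB]
    change ∫ x, v β' x ∂(α' : Measure X) = _
    simp only [hinner]
    rw [integral_add (g := fun x => t * (v σ x - v σ' x)) (integrable_const _)
      (((hi hαB (hvc hσ)).sub (hi hαB (hvc hσ'))).const_mul t),
      integral_const_mul, integral_sub (hi hαB (hvc hσ)) (hi hαB (hvc hσ'))]
    simp
  rw [e3, e1, e2, hαs, hαs', gibbsMassVariation, hmass hρ hσ, hmass hρ hσ', hmass hρ' hσ,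
    hmass hρ' hσ']
  ring

/-- The potentials at `(α, β)`, used as test functions at the displaced measures, incur a penalty of
order `t ^ 2` only. -/
theorem IsSchrodingerPair.OT_displaced_ge
    (h : IsSchrodingerPair (fun x y => C x y / ε) (α : Measure X) (β : Measure X) f g)
    (hC : Continuous fun p : X × X => C p.1 p.2) (hsymm : ∀ x y, C x y = C y x) (hε : 0 < ε)
    (hB : IsCompact B) (hα : α ∈ carriedBy B) (hβ : β ∈ carriedBy B) (hρ : ρ ∈ carriedBy B)
    (hρ' : ρ' ∈ carriedBy B) (hσ : σ ∈ carriedBy B) (hσ' : σ' ∈ carriedBy B)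
    (hα' : IsDisplaced α ρ ρ' t α') (hβ' : IsDisplaced β σ σ' t β') :
    OT C ε α β + ε * (t * ((∫ x, f x ∂(ρ : Measure X) - ∫ x, f x ∂(ρ' : Measure X)) +
      (∫ x, g x ∂(σ : Measure X) - ∫ x, g x ∂(σ' : Measure X))) -
      t ^ 2 * gibbsMassVariation (fun x y => C x y / ε) f g ρ ρ' σ σ') ≤ OT C ε α' β' := by
  have hf := h.continuous_left
  have hg := h.continuous_right
  have hαB := hα'.mem_carriedBy hB.measurableSet hα hρ hρ'
  have hβB := hβ'.mem_carriedBy hB.measurableSet hβ hσ hσ'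
  have hi : ∀ {γ : ProbabilityMeasure X} {φ : X → ℝ}, γ ∈ carriedBy B → Continuous φ →
    Integrable φ (γ : Measure X) := fun hγ hφ => integrable_of_continuous hB hγ hφ
  have hd := dual_le_OT hC hsymm hε hB hαB hβB hf hg
  have hm : ∫ p, Real.exp (f p.1 + g p.2 - C p.1 p.2 / ε)
      ∂((α' : Measure X).prod (β' : Measure X)) = _ :=
    h.gibbsMass_displaced (by fun_prop) (fun x y => by simp only [hsymm x y]) hB hα hβ hρ hρ' hσ
      hσ' hα' hβ'
  rw [hm, hα'.integral_eq (hi hα hf) (hi hαB hf) (hi hρ hf) (hi hρ' hf),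
    hβ'.integral_eq (hi hβ hg) (hi hβB hg) (hi hσ hg) (hi hσ' hg)] at hd
  rw [h.OT_eq hC hsymm hε hB hα hβ]
  refine le_trans (le_of_eq ?_) hd
  ring

/-- The first order expansion of the entropic transport cost. -/
theorem OT_expansion (hC : Continuous fun p : X × X => C p.1 p.2)
    (hsymm : ∀ x y, C x y = C y x) (hε : 0 < ε) (hB : IsCompact B) (hα : α ∈ carriedBy B)
    (hβ : β ∈ carriedBy B) (hρ : ρ ∈ carriedBy B) (hρ' : ρ' ∈ carriedBy B)
    (hσ : σ ∈ carriedBy B) (hσ' : σ' ∈ carriedBy B) (x₀ : X) {ι : Type*} {l : Filter ι}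
    {t : ι → ℝ} {a b : ι → ProbabilityMeasure X} (ht : Tendsto t l (𝓝 0))
    (ha : ∀ᶠ i in l, IsDisplaced α ρ ρ' (t i) (a i))
    (hb : ∀ᶠ i in l, IsDisplaced β σ σ' (t i) (b i)) :
    (fun i => OT C ε (a i) (b i) - OT C ε α β - t i * (ε *
      ((∫ x, leftPotential (fun x y => C x y / ε) x₀ α β x ∂(ρ : Measure X) -
        ∫ x, leftPotential (fun x y => C x y / ε) x₀ α β x ∂(ρ' : Measure X)) +
      (∫ x, rightPotential (fun x y => C x y / ε) x₀ α β x ∂(σ : Measure X) -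
        ∫ x, rightPotential (fun x y => C x y / ε) x₀ α β x ∂(σ' : Measure X))))) =o[l] t := by
  have hc : Continuous fun q : X × X => C q.1 q.2 / ε := by fun_prop
  have hs : ∀ x y, C x y / ε = C y x / ε := fun x y => by rw [hsymm]
  set c : X → X → ℝ := fun x y => C x y / ε with hcdef
  set N : Set (ProbabilityMeasure X) := carriedBy B
  let V : C(X, ℝ) × C(X, ℝ) → ℝ := fun q => gibbsMassVariation c q.1 q.2 ρ ρ' σ σ'
  let A : C(X, ℝ) × C(X, ℝ) → ℝ := fun q =>
    (∫ x, q.1 x ∂(ρ : Measure X) - ∫ x, q.1 x ∂(ρ' : Measure X)) +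
      (∫ x, q.2 x ∂(σ : Measure X) - ∫ x, q.2 x ∂(σ' : Measure X))
  have hI : ∀ γ ∈ N, Continuous fun φ : C(X, ℝ) => ∫ x, φ x ∂(γ : Measure X) := fun γ hγ =>
    (continuousOn_integral hB).comp_continuous (continuous_const.prodMk continuous_id)
      fun φ => ⟨hγ, mem_univ _⟩
  have hV : Continuous V :=
    ((continuous_gibbsMass hc hB hρ hσ).sub (continuous_gibbsMass hc hB hρ hσ')).sub
      ((continuous_gibbsMass hc hB hρ' hσ).sub (continuous_gibbsMass hc hB hρ' hσ'))
  have hA : Continuous A :=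
    (((hI ρ hρ).comp continuous_fst).sub ((hI ρ' hρ').comp continuous_fst)).add
      (((hI σ hσ).comp continuous_snd).sub ((hI σ' hσ').comp continuous_snd))
  let P : ProbabilityMeasure X × ProbabilityMeasure X → C(X, ℝ) × C(X, ℝ) := fun p =>
    (leftPotential c x₀ p.1 p.2, rightPotential c x₀ p.1 p.2)
  have hP : ContinuousOn P (N ×ˢ N) :=
    (continuousOn_leftPotential hc hs hB x₀).prodMk (continuousOn_rightPotential hc hs hB x₀)
  have haN : ∀ᶠ i in l, a i ∈ N := ha.mono fun i hi =>
    hi.mem_carriedBy hB.measurableSet hα hρ hρ'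
  have hbN : ∀ᶠ i in l, b i ∈ N := hb.mono fun i hi =>
    hi.mem_carriedBy hB.measurableSet hβ hσ hσ'
  have hab : Tendsto (fun i => (a i, b i)) l (𝓝[N ×ˢ N] (α, β)) :=
    tendsto_nhdsWithin_iff.2 ⟨(tendsto_of_isDisplaced ht ha).prodMk_nhds
      (tendsto_of_isDisplaced ht hb), haN.mp (hbN.mono fun i h1 h2 => ⟨h2, h1⟩)⟩
  have hPi : Tendsto (fun i => P (a i, b i)) l (𝓝 (P (α, β))) :=
    (hP (α, β) ⟨hα, hβ⟩).tendsto.comp hab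
  have hVi : Tendsto (fun i => V (P (a i, b i))) l (𝓝 (V (P (α, β)))) :=
    (hV.tendsto _).comp hPi
  have hAi : Tendsto (fun i => A (P (a i, b i))) l (𝓝 (A (P (α, β)))) :=
    (hA.tendsto _).comp hPi
  have hsmall : Tendsto (fun i => ε * (|A (P (a i, b i)) - A (P (α, β))| +
      |t i| * (|V (P (a i, b i))| + |V (P (α, β))|))) l (𝓝 0) := by
    have h1 := (hAi.sub_const (A (P (α, β)))).abs
    have h2 := ht.abs.mul (hVi.abs.add_const |V (P (α, β))|)
    simpa using (h1.add h2).const_mul ε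
  rw [Asymptotics.isLittleO_iff]
  intro δ hδ
  filter_upwards [ha, hb, haN, hbN, hsmall.eventually (gt_mem_nhds hδ)] with i h1 h2 h3 h4 h5
  have lower := (potential_spec hc hs hB hα hβ x₀).1.OT_displaced_ge hC hsymm hε hB hα hβ hρ hρ'
    hσ hσ' h1 h2
  -- The lower bound again, from the displaced measures back to `(α, β)` with step `-t`. The slopes
  -- `A₁` and `A₀` differ by `o(1)`, by continuity of the potentials.
  have upper := (potential_spec hc hs hB h3 h4 x₀).1.OT_displaced_ge hC hsymm hε hB h3 h4 hρ hρ'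
    hσ hσ' h1.symm h2.symm
  change OT C ε α β + ε * (t i * A (P (α, β)) - t i ^ 2 * V (P (α, β))) ≤ _ at lower
  change OT C ε (a i) (b i) + ε * (-t i * A (P (a i, b i)) - (-t i) ^ 2 * V (P (a i, b i))) ≤ _
    at upper
  change |OT C ε (a i) (b i) - OT C ε α β - t i * (ε * A (P (α, β)))| ≤ δ * |t i|
  set A₀ := A (P (α, β))
  set A₁ := A (P (a i, b i))
  set V₀ := V (P (α, β))
  set V₁ := V (P (a i, b i))
  have b1 : t i * (A₁ - A₀) ≤ |t i| * |A₁ - A₀| := by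
    rw [← abs_mul]; exact le_abs_self _
  have b2 : t i ^ 2 * V₁ ≤ |t i| * (|t i| * |V₁|) := by
    rw [← mul_assoc, ← sq, sq_abs]
    exact mul_le_mul_of_nonneg_left (le_abs_self _) (sq_nonneg _)
  have b3 : t i ^ 2 * V₀ ≤ |t i| * (|t i| * |V₀|) := by
    rw [← mul_assoc, ← sq, sq_abs]
    exact mul_le_mul_of_nonneg_left (le_abs_self _) (sq_nonneg _)
  have b4 : ε * (|A₁ - A₀| + |t i| * (|V₁| + |V₀|)) * |t i| ≤ δ * |t i| :=
    mul_le_mul_of_nonneg_right h5.le (abs_nonneg _)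
  have n1 : 0 ≤ |t i| * |A₁ - A₀| := by positivity
  have n2 : 0 ≤ |t i| * (|t i| * |V₁|) := by positivity
  have n3 : 0 ≤ |t i| * (|t i| * |V₀|) := by positivity
  refine le_trans ?_ b4
  rw [abs_le]
  constructor
  · have := mul_le_mul_of_nonneg_left (by linarith : t i ^ 2 * V₀ ≤ |t i| * |A₁ - A₀| +
      |t i| * (|t i| * |V₁|) + |t i| * (|t i| * |V₀|)) hε.le
    nlinarith
  · have := mul_le_mul_of_nonneg_left (by linarith : t i * (A₁ - A₀) + t i ^ 2 * V₁ ≤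
      |t i| * |A₁ - A₀| + |t i| * (|t i| * |V₁|) + |t i| * (|t i| * |V₀|)) hε.le
    nlinarith

/-- The gradient of the Sinkhorn divergence in its first variable. -/
def gradLeft (C : X → X → ℝ) (ε : ℝ) (x₀ : X) (α β : ProbabilityMeasure X) : C(X, ℝ) :=
  ε • (leftPotential (fun x y => C x y / ε) x₀ α β - symmPotential (fun x y => C x y / ε) x₀ α)

/-- The gradient of the Sinkhorn divergence in its second variable. -/
def gradRight (C : X → X → ℝ) (ε : ℝ) (x₀ : X) (α β : ProbabilityMeasure X) : C(X, ℝ) :=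
  ε • (rightPotential (fun x y => C x y / ε) x₀ α β - symmPotential (fun x y => C x y / ε) x₀ β)

theorem isGradientAt_divergence (hC : Continuous fun p : X × X => C p.1 p.2)
    (hsymm : ∀ x y, C x y = C y x) (hε : 0 < ε) {A : Set (ProbabilityMeasure X)}
    (hA : ∀ α ∈ A, ∃ B, IsCompact B ∧ α ∈ carriedBy B) (hα : α ∈ A) (hβ : β ∈ A) (x₀ : X) :
    IsGradientAt (divergence C ε) A α β (gradLeft C ε x₀ α β) (gradRight C ε x₀ α β) := by
  intro ρ hρ ρ' hρ' σ hσ σ' hσ' δ hδ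
  obtain ⟨B₁, hB₁, h₁⟩ := hA α hα
  obtain ⟨B₂, hB₂, h₂⟩ := hA β hβ
  obtain ⟨B₃, hB₃, h₃⟩ := hA ρ hρ
  obtain ⟨B₄, hB₄, h₄⟩ := hA ρ' hρ'
  obtain ⟨B₅, hB₅, h₅⟩ := hA σ hσ
  obtain ⟨B₆, hB₆, h₆⟩ := hA σ' hσ'
  have hB : IsCompact (B₁ ∪ B₂ ∪ B₃ ∪ B₄ ∪ B₅ ∪ B₆) :=
    ((((hB₁.union hB₂).union hB₃).union hB₄).union hB₅).union hB₆
  set B := B₁ ∪ B₂ ∪ B₃ ∪ B₄ ∪ B₅ ∪ B₆ with hBdef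
  replace h₁ : α ∈ carriedBy B := carriedBy_mono (fun x hx => by simp [hBdef, hx]) h₁
  replace h₂ : β ∈ carriedBy B := carriedBy_mono (fun x hx => by simp [hBdef, hx]) h₂
  replace h₃ : ρ ∈ carriedBy B := carriedBy_mono (fun x hx => by simp [hBdef, hx]) h₃
  replace h₄ : ρ' ∈ carriedBy B := carriedBy_mono (fun x hx => by simp [hBdef, hx]) h₄
  replace h₅ : σ ∈ carriedBy B := carriedBy_mono (fun x hx => by simp [hBdef, hx]) h₅
  replace h₆ : σ' ∈ carriedBy B := carriedBy_mono (fun x hx => by simp [hBdef, hx]) h₆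
  let D : Set (ℝ × ProbabilityMeasure X × ProbabilityMeasure X) :=
    {q | IsDisplaced α ρ ρ' q.1 q.2.1 ∧ IsDisplaced β σ σ' q.1 q.2.2}
  -- The filter `t → 0` over all admissible triples `(t, α', β')`, so that an `o(t)` along it is
  -- uniform in `α'` and `β'`.
  let l : Filter (ℝ × ProbabilityMeasure X × ProbabilityMeasure X) :=
    comap Prod.fst (𝓝 0) ⊓ 𝓟 D
  have ht : Tendsto (fun q : ℝ × ProbabilityMeasure X × ProbabilityMeasure X => q.1) l (𝓝 0) :=
    tendsto_comap.mono_left inf_le_left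
  have hD : ∀ᶠ q in l, q ∈ D := mem_inf_of_right (mem_principal_self D)
  have hDa : ∀ᶠ q in l, IsDisplaced α ρ ρ' q.1 q.2.1 := hD.mono fun q hq => hq.1
  have hDb : ∀ᶠ q in l, IsDisplaced β σ σ' q.1 q.2.2 := hD.mono fun q hq => hq.2
  have o₁ := OT_expansion hC hsymm hε hB h₁ h₂ h₃ h₄ h₅ h₆ x₀ ht hDa hDb
  -- In a self-cost both arguments move together. Half of the sum of the left and right potentials
  -- appears, which is the symmetric potential.
  have o₂ := OT_expansion hC hsymm hε hB h₁ h₁ h₃ h₄ h₃ h₄ x₀ ht hDa hDa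
  have o₃ := OT_expansion hC hsymm hε hB h₂ h₂ h₅ h₆ h₅ h₆ x₀ ht hDb hDb
  have o := (o₁.sub (o₂.const_mul_left (1 / 2))).sub (o₃.const_mul_left (1 / 2))
  have hev := (Asymptotics.isLittleO_iff.1 o) hδ
  rw [eventually_inf_principal, eventually_comap, Metric.eventually_nhds_iff] at hev
  obtain ⟨η, hη, H⟩ := hev
  refine ⟨η, hη, fun t ht α' β' hα' hβ' => ?_⟩
  have := H (by simpa using ht) (t, α', β') rfl ⟨hα', hβ'⟩
  rw [Real.norm_eq_abs, Real.norm_eq_abs] at this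
  refine le_trans (le_of_eq (congrArg _ ?_)) this
  have hi : ∀ {γ : ProbabilityMeasure X} (φ : C(X, ℝ)), γ ∈ carriedBy B →
    Integrable φ (γ : Measure X) := fun φ hγ => integrable_of_continuous hB hγ φ.continuous
  have hcomb : ∀ {γ : ProbabilityMeasure X} (a b d : C(X, ℝ)), γ ∈ carriedBy B →
      ∫ x, (ε • (a - (1 / 2 : ℝ) • (b + d))) x ∂(γ : Measure X) =
      ε * (∫ x, a x ∂(γ : Measure X) -
        (1 / 2) * (∫ x, b x ∂(γ : Measure X) + ∫ x, d x ∂(γ : Measure X))) := by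
    intro γ a b d hγ
    simp only [ContinuousMap.smul_apply, ContinuousMap.sub_apply, ContinuousMap.add_apply,
      smul_eq_mul]
    rw [integral_const_mul, integral_sub (g := fun x => (1 / 2) * (b x + d x)) (hi _ hγ)
      (((hi _ hγ).add (hi _ hγ)).const_mul _), integral_const_mul,
      integral_add (hi _ hγ) (hi _ hγ)]
  simp only [gradLeft, gradRight, symmPotential]
  rw [hcomb _ _ _ h₃, hcomb _ _ _ h₄, hcomb _ _ _ h₅, hcomb _ _ _ h₆]
  simp only [divergence]
  ring

end Gradient

/-! ### The theorem for positive definite kernels -/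

section Main

variable {X : Type*} [MeasurableSpace X] [TopologicalSpace X] [T2Space X] [BorelSpace X]
  [SecondCountableTopology X] {C : X → X → ℝ} {ε : ℝ}

theorem isSmoothConvexDivergence_divergence (hC : Continuous fun p : X × X => C p.1 p.2)
    (hsymm : ∀ x y, C x y = C y x) (hε : 0 < ε) (hk : IsPositiveDefinite (gibbsKernel C ε))
    {A : Set (ProbabilityMeasure X)} (hA : ∀ α ∈ A, ∃ B, IsCompact B ∧ α ∈ carriedBy B)
    {𝓕 : Set (Set (ProbabilityMeasure X))} (h𝓕 : ∀ N ∈ 𝓕, ∃ B, IsCompact B ∧ N = carriedBy B) :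
    IsSmoothConvexDivergence (divergence C ε) A 𝓕 := by
  have hA₂ : ∀ α ∈ A, ∀ β ∈ A, ∃ B, IsCompact B ∧ α ∈ carriedBy B ∧ β ∈ carriedBy B := by
    intro α hα β hβ
    obtain ⟨B₁, hB₁, h₁⟩ := hA α hα
    obtain ⟨B₂, hB₂, h₂⟩ := hA β hβ
    exact ⟨B₁ ∪ B₂, hB₁.union hB₂, carriedBy_mono subset_union_left h₁,
      carriedBy_mono subset_union_right h₂⟩
  have hA₃ : ∀ α ∈ A, ∀ β ∈ A, ∀ γ ∈ A, ∃ B, IsCompact B ∧ α ∈ carriedBy B ∧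
      β ∈ carriedBy B ∧ γ ∈ carriedBy B := by
    intro α hα β hβ γ hγ
    obtain ⟨B₁, hB₁, h₁, h₂⟩ := hA₂ α hα β hβ
    obtain ⟨B₃, hB₃, h₃⟩ := hA γ hγ
    exact ⟨B₁ ∪ B₃, hB₁.union hB₃, carriedBy_mono subset_union_left h₁,
      carriedBy_mono subset_union_left h₂, carriedBy_mono subset_union_right h₃⟩
  have hself : ∀ β : ProbabilityMeasure X, divergence C ε β β = 0 := fun β => by
    rw [divergence]; ring
  have hc : Continuous fun q : X × X => C q.1 q.2 / ε := by fun_prop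
  have hs : ∀ x y, C x y / ε = C y x / ε := fun x y => by rw [hsymm]
  refine ⟨?_, fun β _ => hself β, ?_, ?_, ?_, ?_, ?_, ?_, ?_⟩
  · intro α hα β hβ
    obtain ⟨B, hB, h₁, h₂⟩ := hA₂ α hα β hβ
    exact divergence_comm hC hsymm hε hB h₁ h₂
  · intro α hα β hβ
    obtain ⟨B, hB, h₁, h₂⟩ := hA₂ α hα β hβ
    exact (divergence_nonneg_and_eq hC hsymm hε hB hk h₁ h₂).1
  · intro α hα β hβ
    obtain ⟨B, hB, h₁, h₂⟩ := hA₂ α hα β hβ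
    refine ⟨(divergence_nonneg_and_eq hC hsymm hε hB hk h₁ h₂).2, ?_⟩
    rintro rfl
    exact hself α
  · intro α₀ h₀ α₁ h₁ β hβ a b ha hb hab α h
    obtain ⟨B, hB, h₀, h₁, h₂⟩ := hA₃ α₀ h₀ α₁ h₁ β hβ
    exact divergence_convex_left hC hsymm hε hk hB h₀ h₁ h₂ ha hb hab h
  · intro α hα β₀ h₀ β₁ h₁ a b ha hb hab β h
    obtain ⟨B, hB, h₀, h₁, h₂⟩ := hA₃ β₀ h₀ β₁ h₁ α hα
    rw [divergence_comm hC hsymm hε hB h₂ (carriedBy_of_mixture h₀ h₁ h),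
      divergence_comm hC hsymm hε hB h₂ h₀, divergence_comm hC hsymm hε hB h₂ h₁]
    exact divergence_convex_left hC hsymm hε hk hB h₀ h₁ h₂ ha hb hab h
  · intro N hN
    obtain ⟨B, hB, rfl⟩ := h𝓕 N hN
    exact continuousOn_divergence hC hsymm hε hB
  · rcases isEmpty_or_nonempty X with hX | ⟨⟨x₀⟩⟩
    · exact ⟨fun _ _ => 0, fun _ _ => 0,
        fun α => isEmptyElim (α : Measure X).nonempty_of_neZero.some,
        fun N _ => ⟨continuousOn_const, continuousOn_const⟩⟩
    · refine ⟨gradLeft C ε x₀, gradRight C ε x₀, fun α hα β hβ =>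
        isGradientAt_divergence hC hsymm hε hA hα hβ x₀, fun N hN => ?_⟩
      obtain ⟨B, hB, rfl⟩ := h𝓕 N hN
      have hp := continuousOn_symmPotential hc hs hB x₀
      have hp₁ : ContinuousOn (fun p : ProbabilityMeasure X × ProbabilityMeasure X =>
          symmPotential (fun x y => C x y / ε) x₀ p.1) (carriedBy B ×ˢ carriedBy B) :=
        hp.comp continuousOn_fst fun p hp => hp.1
      have hp₂ : ContinuousOn (fun p : ProbabilityMeasure X × ProbabilityMeasure X =>
          symmPotential (fun x y => C x y / ε) x₀ p.2) (carriedBy B ×ˢ carriedBy B) :=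
        hp.comp continuousOn_snd fun p hp => hp.2
      exact ⟨((continuousOn_leftPotential hc hs hB x₀).sub hp₁).const_smul ε,
        ((continuousOn_rightPotential hc hs hB x₀).sub hp₂).const_smul ε⟩
  · intro N hN α α' hα hα'
    obtain ⟨B, hB, rfl⟩ := h𝓕 N hN
    exact divergence_metrizes hC hsymm hε hk hB hα hα'

end Main

/-! ### Positive universal kernels on compact spaces -/

section CompactKernel

theorem IsPositiveKernel.finset_sum_nonneg {X : Type*} {k : X → X → ℝ} (h : IsPositiveKernel k)
    (R : Finset X) (a : X → ℝ) : 0 ≤ ∑ x ∈ R, ∑ y ∈ R, a x * a y * k x y := by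
  have e : ∀ F : X → X → ℝ, ∑ x ∈ R, ∑ y ∈ R, F x y =
      ∑ i, ∑ j, F (R.equivFin.symm i) (R.equivFin.symm j) := by
    intro F
    rw [← Finset.sum_coe_sort, ← Equiv.sum_comp R.equivFin.symm]
    refine Finset.sum_congr rfl fun i _ => ?_
    rw [← Finset.sum_coe_sort, ← Equiv.sum_comp R.equivFin.symm]
  rw [e]
  exact h.2 _ (fun i => (R.equivFin.symm i : X)) (fun i => a (R.equivFin.symm i))

theorem integral_comp_simpleFunc {X Y : Type*} [MeasurableSpace X] {μ : Measure X}
    [IsFiniteMeasure μ] (s : SimpleFunc X Y) (φ : Y → ℝ) :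
    ∫ x, φ (s x) ∂μ = ∑ i ∈ s.range, μ.real (s ⁻¹' {i}) * φ i := by
  classical
  have h : ∀ x, φ (s x) = ∑ i ∈ s.range, (s ⁻¹' {i}).indicator (fun _ => φ i) x := by
    intro x
    have h1 : ∀ i ∈ s.range, i ≠ s x → (s ⁻¹' {i}).indicator (fun _ => φ i) x = 0 :=
      fun i _ hi => indicator_of_notMem (s := s ⁻¹' {i}) (fun hx => hi (Eq.symm hx)) _
    rw [Finset.sum_eq_single_of_mem (s x) (s.mem_range_self x) h1]
    rw [indicator_of_mem (show x ∈ s ⁻¹' {s x} from rfl)]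
  simp only [h]
  rw [integral_finsetSum _ fun i _ => (integrable_const _).indicator (s.measurableSet_fiber i)]
  simp_rw [integral_indicator_const _ (s.measurableSet_fiber _), smul_eq_mul]

variable {X : Type*} [MetricSpace X] [CompactSpace X] [MeasurableSpace X] [BorelSpace X]
  {k : X → X → ℝ} {μ ν : Measure X} [IsFiniteMeasure μ] [IsFiniteMeasure ν]

theorem energy_eq_integral_prod (hk : Continuous fun p : X × X => k p.1 p.2) :
    energy k μ ν = ∫ p, k p.1 p.2 ∂(μ.prod ν) :=
  (MeasureTheory.integral_prod _ (integrable_of_continuous isCompact_univ (by simp) hk)).symm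

/-- Simple maps `s n` converging to the identity push `μ` and `ν` to discrete measures. There the
expression is a Gram form with coefficients the differences of masses of the fibers. Dominated
convergence passes to the limit. -/
theorem energy_nonneg (hk : Continuous fun p : X × X => k p.1 p.2) (hpos : IsPositiveKernel k) :
    0 ≤ energy k μ μ + energy k ν ν - 2 * energy k μ ν := by
  rcases isEmpty_or_nonempty X with hX | ⟨⟨x₀⟩⟩
  · have h0 : ∀ μ : Measure X, μ = 0 := fun μ => Measure.eq_zero_of_isEmpty μ
    simp [energy, h0 μ, h0 ν]
  obtain ⟨M, hM⟩ := (isCompact_univ (X := X × X)).exists_bound_of_continuousOn hk.continuousOn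
  let s : ℕ → SimpleFunc X X := SimpleFunc.approxOn id measurable_id univ x₀ (mem_univ _)
  have hs : ∀ x, Tendsto (fun n => s n x) atTop (𝓝 x) := fun x =>
    SimpleFunc.tendsto_approxOn measurable_id (mem_univ _) (by simp)
  have hmeas : ∀ n, Measurable fun p : X × X => k (s n p.1) (s n p.2) := fun n =>
    hk.measurable.comp (((s n).measurable.comp measurable_fst).prodMk
      ((s n).measurable.comp measurable_snd))
  have hlim : ∀ (m m' : Measure X) [IsFiniteMeasure m] [IsFiniteMeasure m'],
      Tendsto (fun n => ∫ p, k (s n p.1) (s n p.2) ∂(m.prod m')) atTop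
        (𝓝 (energy k m m')) := by
    intro m m' _ _
    rw [energy_eq_integral_prod hk]
    refine tendsto_integral_filter_of_norm_le_const
      (Eventually.of_forall fun n => (hmeas n).aestronglyMeasurable)
      ⟨M, Eventually.of_forall fun n => Eventually.of_forall fun p => hM (_, _) (mem_univ _)⟩
      (Eventually.of_forall fun p => ?_)
    exact (hk.tendsto (p.1, p.2)).comp ((hs p.1).prodMk_nhds (hs p.2))
  have hsum : ∀ (n : ℕ) (m m' : Measure X) [IsFiniteMeasure m] [IsFiniteMeasure m'],
      ∫ p, k (s n p.1) (s n p.2) ∂(m.prod m') = ∑ i ∈ (s n).range, ∑ j ∈ (s n).range,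
        m.real (s n ⁻¹' {i}) * m'.real (s n ⁻¹' {j}) * k i j := by
    intro n m m' _ _
    rw [MeasureTheory.integral_prod _ (Integrable.of_bound (hmeas n).aestronglyMeasurable M
      (Eventually.of_forall fun p => hM (_, _) (mem_univ _)))]
    have inner : ∀ x, ∫ y, k (s n x) (s n y) ∂m' =
      ∑ j ∈ (s n).range, m'.real (s n ⁻¹' {j}) * k (s n x) j := fun x =>
      integral_comp_simpleFunc (s n) (fun y => k (s n x) y)
    simp only [inner]
    rw [integral_comp_simpleFunc (s n)
      (fun x => ∑ j ∈ (s n).range, m'.real (s n ⁻¹' {j}) * k x j)]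
    refine Finset.sum_congr rfl fun i _ => ?_
    rw [Finset.mul_sum]
    exact Finset.sum_congr rfl fun j _ => by ring
  refine ge_of_tendsto' (((hlim μ μ).add (hlim ν ν)).sub ((hlim μ ν).const_mul 2)) fun n => ?_
  have := hpos.finset_sum_nonneg (s n).range
    fun i => μ.real (s n ⁻¹' {i}) - ν.real (s n ⁻¹' {i})
  refine this.trans (le_of_eq ?_)
  have hswap : ∑ i ∈ (s n).range, ∑ j ∈ (s n).range,
      ν.real (s n ⁻¹' {i}) * μ.real (s n ⁻¹' {j}) * k i j =
      ∑ i ∈ (s n).range, ∑ j ∈ (s n).range,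
        μ.real (s n ⁻¹' {i}) * ν.real (s n ⁻¹' {j}) * k i j := by
    rw [Finset.sum_comm]
    refine Finset.sum_congr rfl fun i _ => Finset.sum_congr rfl fun j _ => ?_
    rw [hpos.1 j i]; ring
  rw [hsum, hsum, hsum, two_mul]
  nth_rewrite 1 [← hswap]
  simp only [← Finset.sum_add_distrib, ← Finset.sum_sub_distrib]
  refine Finset.sum_congr rfl fun i _ => Finset.sum_congr rfl fun j _ => ?_
  ring

theorem energy_comm (hk : Continuous fun p : X × X => k p.1 p.2)
    (hsymm : ∀ x y, k x y = k y x) : energy k μ ν = energy k ν μ := by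
  rw [energy, integral_integral_swap (integrable_of_continuous isCompact_univ (by simp) hk), energy]
  simp_rw [hsymm]

theorem continuous_integral_kernel (hk : Continuous fun p : X × X => k p.1 p.2) :
    Continuous fun x => ∫ y, k x y ∂ν := by
  have := continuous_parametric_integral_of_continuous (μ := ν) (f := k) hk
    (isCompact_univ (X := X))
  simpa using this

theorem energy_add_dirac (hk : Continuous fun p : X × X => k p.1 p.2) (x : X) {t : ℝ}
    (ht : 0 ≤ t) : energy k (μ + ENNReal.ofReal t • Measure.dirac x) ν =
      energy k μ ν + t * ∫ y, k x y ∂ν := by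
  have hi : ∀ (m : Measure X) [IsFiniteMeasure m], Integrable (fun x => ∫ y, k x y ∂ν) m :=
    fun m _ => integrable_of_continuous isCompact_univ (by simp) (continuous_integral_kernel hk)
  rw [energy, integral_add_measure (hi μ) ((hi _).smul_measure ENNReal.ofReal_ne_top),
    integral_smul_measure, ENNReal.toReal_ofReal ht, integral_dirac, smul_eq_mul, energy]

/-- Zero is the minimum of the energy, so adding `t δ_x` to `μ` cannot decrease it. Dividing the
variation by `t` and letting `t → 0+` gives the inequality. Perturbing by a positive mass stays
among measures. -/
theorem integral_kernel_le_of_energy_eq_zero (hk : Continuous fun p : X × X => k p.1 p.2)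
    (hpos : IsPositiveKernel k) (h : energy k μ μ + energy k ν ν - 2 * energy k μ ν = 0) (x : X) :
    ∫ y, k x y ∂ν ≤ ∫ y, k x y ∂μ := by
  by_contra hlt
  push Not at hlt
  set a := ∫ y, k x y ∂ν - ∫ y, k x y ∂μ with ha
  have key : ∀ t : ℝ, 0 < t → 0 ≤ t * k x x - 2 * a := by
    intro t ht
    let m := μ + ENNReal.ofReal t • Measure.dirac x
    have : IsFiniteMeasure (ENNReal.ofReal t • Measure.dirac x) :=
      (Measure.dirac x).smul_finite ENNReal.ofReal_ne_top
    have h0 : 0 ≤ energy k m m + energy k ν ν - 2 * energy k m ν := energy_nonneg hk hpos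
    have e1 : energy k m ν = energy k μ ν + t * ∫ y, k x y ∂ν := energy_add_dirac hk x ht.le
    have e2 : energy k m m = energy k μ m + t * ∫ y, k x y ∂m := energy_add_dirac hk x ht.le
    have e3 : energy k μ m = energy k μ μ + t * ∫ y, k x y ∂μ := by
      rw [energy_comm hk hpos.1]; exact energy_add_dirac hk x ht.le
    have e4 : ∫ y, k x y ∂m = ∫ y, k x y ∂μ + t * k x x := by
      have hi : ∀ (m : Measure X) [IsFiniteMeasure m], Integrable (fun y => k x y) m :=
        fun m _ => integrable_of_continuous isCompact_univ (by simp) (by fun_prop)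
      rw [integral_add_measure (hi μ) ((hi _).smul_measure ENNReal.ofReal_ne_top),
        integral_smul_measure, ENNReal.toReal_ofReal ht.le, integral_dirac, smul_eq_mul]
    rw [e2, e3, e4, e1] at h0
    have h1 : 0 ≤ t * (t * k x x - 2 * a) := by rw [ha]; linarith
    exact nonneg_of_mul_nonneg_right h1 ht
  have hlim : Tendsto (fun t : ℝ => t * k x x - 2 * a) (𝓝[>] 0) (𝓝 (0 * k x x - 2 * a)) :=
    ((tendsto_id.mono_left nhdsWithin_le_nhds).mul_const _).sub_const _
  have := ge_of_tendsto hlim (eventually_nhdsWithin_of_forall key)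
  linarith

theorem continuous_integral_continuousMap : Continuous fun f : C(X, ℝ) => ∫ x, f x ∂μ := by
  rw [continuous_iff_continuousAt]
  intro f₀
  refine tendsto_integral_filter_of_norm_le_const
    (Eventually.of_forall fun f => f.continuous.aestronglyMeasurable) ⟨‖f₀‖ + 1, ?_⟩
    (Eventually.of_forall fun x => (continuous_eval_const x).tendsto f₀)
  filter_upwards [continuous_norm.continuousAt.eventually (gt_mem_nhds (lt_add_one ‖f₀‖))]
    with f hf
  exact Eventually.of_forall fun x => (f.norm_coe_le_norm x).trans hf.le

/-- Continuous positive universal kernels on compact spaces have positive definite energies. -/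
theorem isPositiveDefinite_of_universal (hk : Continuous fun p : X × X => k p.1 p.2)
    (hpos : IsPositiveKernel k) (huniv : IsUniversalKernel k) : IsPositiveDefinite k := by
  intro B _ μ ν _ _ _ _
  refine ⟨energy_nonneg hk hpos, fun h => ?_⟩
  -- The condition is symmetric in `μ` and `ν`, so the one-sided inequality applies twice.
  have hker : ∀ x, ∫ y, k x y ∂μ = ∫ y, k x y ∂ν := fun x =>
    le_antisymm (integral_kernel_le_of_energy_eq_zero hk hpos
      (by rw [energy_comm hk hpos.1 (μ := ν) (ν := μ)]; linarith) x)
      (integral_kernel_le_of_energy_eq_zero hk hpos h x)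
  have hspan : ∀ φ ∈ Submodule.span ℝ (range k),
      Continuous φ ∧ ∫ y, φ y ∂μ = ∫ y, φ y ∂ν := by
    intro φ hφ
    have hi : ∀ {φ : X → ℝ} (m : Measure X) [IsFiniteMeasure m], Continuous φ →
      Integrable φ m := fun m _ hφ => integrable_of_continuous isCompact_univ (by simp) hφ
    induction hφ using Submodule.span_induction with
    | mem φ hφ =>
      obtain ⟨x, rfl⟩ := hφ
      exact ⟨by fun_prop, hker x⟩
    | zero => exact ⟨continuous_zero, by simp⟩
    | add φ ψ _ _ h1 h2 =>
      refine ⟨h1.1.add h2.1, ?_⟩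
      rw [integral_add' (hi _ h1.1) (hi _ h2.1), integral_add' (hi _ h1.1) (hi _ h2.1), h1.2, h2.2]
    | smul a φ _ h1 =>
      refine ⟨h1.1.const_smul a, ?_⟩
      simp only [Pi.smul_apply, integral_smul, h1.2]
  have hclosed : IsClosed {f : C(X, ℝ) | ∫ y, f y ∂μ = ∫ y, f y ∂ν} :=
    isClosed_eq continuous_integral_continuousMap continuous_integral_continuousMap
  have hall : ∀ f : C(X, ℝ), ∫ y, f y ∂μ = ∫ y, f y ∂ν := fun f =>
    hclosed.closure_subset_iff.2 (fun f hf => (hspan f hf).2) (huniv f)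
  exact ext_of_forall_integral_eq_of_IsFiniteMeasure fun f => hall f.toContinuousMap

end CompactKernel

/-! ### Translation invariant kernels and Fourier transforms -/

section CharacteristicFunction

open scoped RealInnerProductSpace ComplexConjugate

variable {E : Type*} [NormedAddCommGroup E] [InnerProductSpace ℝ E] [FiniteDimensional ℝ E]
  [MeasurableSpace E] [BorelSpace E] {k : E → E → ℝ} {γ μ ν : Measure E} [IsFiniteMeasure γ]
  [IsFiniteMeasure μ] [IsFiniteMeasure ν]

theorem integrable_charFun_mul_conj :
    Integrable (fun ξ => charFun μ ξ * conj (charFun ν ξ)) γ := by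
  refine Integrable.of_bound (by fun_prop) (μ.real univ * ν.real univ)
    (Eventually.of_forall fun ξ => ?_)
  rw [norm_mul, RCLike.norm_conj]
  exact mul_le_mul (norm_charFun_le ξ) (norm_charFun_le ξ) (norm_nonneg _) measureReal_nonneg

/-- The energy of a kernel given by a characteristic function. -/
theorem energy_eq_integral_charFun (hk : ∀ x y, (k x y : ℂ) = charFun γ (x - y)) :
    (energy k μ ν : ℂ) = ∫ ξ, charFun μ ξ * conj (charFun ν ξ) ∂γ := by
  have h1 : ∀ x y ξ : E, Complex.exp (⟪ξ, x - y⟫ * Complex.I) =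
      Complex.exp (⟪x, ξ⟫ * Complex.I) * Complex.exp (⟪y, -ξ⟫ * Complex.I) := by
    intro x y ξ
    rw [← Complex.exp_add, inner_sub_right, inner_neg_right, real_inner_comm ξ x,
      real_inner_comm ξ y]
    push_cast
    ring_nf
  have hexp : ∀ x ξ : E, ‖Complex.exp (⟪x, ξ⟫ * Complex.I)‖ = 1 := fun x ξ =>
    Complex.norm_exp_ofReal_mul_I _
  have inner : ∀ x, ∫ y, (k x y : ℂ) ∂ν =
      ∫ ξ, Complex.exp (⟪x, ξ⟫ * Complex.I) * conj (charFun ν ξ) ∂γ := by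
    intro x
    simp only [hk, charFun_apply (μ := γ), h1]
    rw [integral_integral_swap (f := fun y ξ => Complex.exp (⟪x, ξ⟫ * Complex.I) *
      Complex.exp (⟪y, -ξ⟫ * Complex.I))]
    · refine integral_congr_ae (Eventually.of_forall fun ξ => ?_)
      simp only
      rw [integral_const_mul, ← charFun_neg, charFun_apply (μ := ν)]
    · refine Integrable.of_bound (C := 1) (Continuous.aestronglyMeasurable (by fun_prop))
        (Eventually.of_forall fun p => ?_)
      simp only [Function.uncurry]
      rw [norm_mul, hexp, hexp, one_mul]
  have e : (energy k μ ν : ℂ) = ∫ x, ∫ y, (k x y : ℂ) ∂ν ∂μ := by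
    rw [energy, ← integral_complex_ofReal]
    refine integral_congr_ae (Eventually.of_forall fun x => ?_)
    exact integral_complex_ofReal.symm
  rw [e]
  simp only [inner]
  rw [integral_integral_swap (f := fun x ξ => Complex.exp (⟪x, ξ⟫ * Complex.I) *
    conj (charFun ν ξ))]
  · refine integral_congr_ae (Eventually.of_forall fun ξ => ?_)
    simp only
    rw [integral_mul_const, charFun_apply (μ := μ)]
  · refine Integrable.of_bound (C := ν.real univ) (Continuous.aestronglyMeasurable (by fun_prop))
      (Eventually.of_forall fun p => ?_)
    simp only [Function.uncurry]
    rw [norm_mul, hexp, RCLike.norm_conj, one_mul]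
    exact norm_charFun_le _

theorem energy_sub_eq_integral_sq (hk : ∀ x y, (k x y : ℂ) = charFun γ (x - y)) :
    energy k μ μ + energy k ν ν - 2 * energy k μ ν =
      ∫ ξ, ‖charFun μ ξ - charFun ν ξ‖ ^ 2 ∂γ := by
  have hre : ∀ (m m' : Measure E) [IsFiniteMeasure m] [IsFiniteMeasure m'],
      energy k m m' = ∫ ξ, (charFun m ξ * conj (charFun m' ξ)).re ∂γ := by
    intro m m' _ _
    have := congrArg Complex.re (energy_eq_integral_charFun (μ := m) (ν := m') hk)
    rw [Complex.ofReal_re] at this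
    rw [this]
    exact (integral_re integrable_charFun_mul_conj).symm
  have hi : ∀ (m m' : Measure E) [IsFiniteMeasure m] [IsFiniteMeasure m'],
      Integrable (fun ξ => (charFun m ξ * conj (charFun m' ξ)).re) γ := fun m m' _ _ =>
    integrable_charFun_mul_conj.re
  rw [hre, hre, hre, ← integral_const_mul, ← integral_add (hi μ μ) (hi ν ν),
    ← integral_sub (by exact (hi μ μ).add (hi ν ν)) ((hi μ ν).const_mul 2)]
  refine integral_congr_ae (Eventually.of_forall fun ξ => ?_)
  simp only [Complex.sq_norm, Complex.normSq_sub, Complex.mul_conj, Complex.ofReal_re]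

/-- Positive definiteness of translation invariant kernels, by Bochner's formula. -/
theorem energy_sub_nonneg_and_eq_of_charFun (hγ : (volume : Measure E) ≪ γ)
    (hk : ∀ x y, (k x y : ℂ) = charFun γ (x - y)) :
    0 ≤ energy k μ μ + energy k ν ν - 2 * energy k μ ν ∧
      (energy k μ μ + energy k ν ν - 2 * energy k μ ν = 0 → μ = ν) := by
  rw [energy_sub_eq_integral_sq hk]
  refine ⟨integral_nonneg fun ξ => sq_nonneg _, fun h => ?_⟩
  have hb : Integrable (fun ξ => ‖charFun μ ξ - charFun ν ξ‖ ^ 2) γ := by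
    refine Integrable.of_bound (Continuous.aestronglyMeasurable (by fun_prop))
      ((μ.real univ + ν.real univ) ^ 2) (Eventually.of_forall fun ξ => ?_)
    rw [Real.norm_of_nonneg (sq_nonneg _)]
    exact pow_le_pow_left₀ (norm_nonneg _) ((norm_sub_le _ _).trans
      (add_le_add (norm_charFun_le ξ) (norm_charFun_le ξ))) 2
  rw [integral_eq_zero_iff_of_nonneg (fun ξ => sq_nonneg _) hb] at h
  -- Equality `γ`-almost everywhere passes to Lebesgue measure because `volume ≪ γ`, and then to
  -- every point by continuity.
  have h2 : charFun μ =ᵐ[volume] charFun ν := by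
    filter_upwards [hγ.ae_le h] with ξ hξ
    simpa [sub_eq_zero] using hξ
  exact Measure.ext_of_charFun ((continuous_charFun.ae_eq_iff_eq volume continuous_charFun).1 h2)

/-- The finite measure with characteristic function `exp (-s ‖v‖ ^ 2)`. -/
theorem exists_measure_charFun_gaussian {s : ℝ} (hs : 0 < s) :
    ∃ γ : Measure E, IsFiniteMeasure γ ∧ (volume : Measure E) ≪ γ ∧
      ∀ v, charFun γ v = (Real.exp (-s * ‖v‖ ^ 2) : ℂ) := by
  -- The Fourier transform of `exp (-b ‖ξ‖ ^ 2)` is proportional to `exp (-‖v‖ ^ 2 / (4 * b))`, so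
  -- `b = 1 / (4 * s)`.
  set b : ℝ := 1 / (4 * s) with hb
  have hb0 : 0 < b := by positivity
  set Z : ℝ := ∫ ξ : E, Real.exp (-b * ‖ξ‖ ^ 2) with hZ
  have hZ0 : 0 < Z := by
    rw [hZ, GaussianFourier.integral_rexp_neg_mul_sq_norm hb0]
    positivity
  have hint : Integrable fun ξ : E => Real.exp (-b * ‖ξ‖ ^ 2) :=
    Integrable.of_integral_ne_zero hZ0.ne'
  have hZc : (Z : ℂ) = (Real.pi / (b : ℂ)) ^ (Module.finrank ℝ E / 2 : ℂ) := by
    rw [← GaussianFourier.integral_cexp_neg_mul_sq_norm (V := E) (b := (b : ℂ)) (by simpa),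
      hZ, ← integral_complex_ofReal]
    refine integral_congr_ae (Eventually.of_forall fun ξ => ?_)
    push_cast
    rfl
  have hm : Measurable fun ξ : E => ENNReal.ofReal (Z⁻¹ * Real.exp (-b * ‖ξ‖ ^ 2)) := by
    fun_prop
  refine ⟨volume.withDensity fun ξ => ENNReal.ofReal (Z⁻¹ * Real.exp (-b * ‖ξ‖ ^ 2)),
    isFiniteMeasure_withDensity_ofReal (hint.const_mul _).2,
    withDensity_absolutelyContinuous' hm.aemeasurable (Eventually.of_forall fun ξ => ?_),
    fun v => ?_⟩
  · rw [Ne, ENNReal.ofReal_eq_zero, not_le]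
    positivity
  · rw [charFun_apply, integral_withDensity_eq_integral_toReal_smul hm (by simp)]
    have e : ∀ ξ : E, (ENNReal.ofReal (Z⁻¹ * Real.exp (-b * ‖ξ‖ ^ 2))).toReal •
        Complex.exp (⟪ξ, v⟫ * Complex.I) =
        (Z : ℂ)⁻¹ * Complex.exp (-(b : ℂ) * ‖ξ‖ ^ 2 + Complex.I * ⟪v, ξ⟫) := by
      intro ξ
      rw [ENNReal.toReal_ofReal (by positivity), Complex.real_smul, Complex.exp_add,
        real_inner_comm]
      push_cast
      ring_nf
    simp only [e]
    have hZ0' : (Z : ℂ) ≠ 0 := by exact_mod_cast hZ0.ne'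
    rw [integral_const_mul, GaussianFourier.integral_cexp_neg_mul_sq_norm_add (by simpa), ← hZc,
      inv_mul_cancel_left₀ hZ0', Complex.ofReal_exp, hb]
    congr 1
    have hs' : (s : ℂ) ≠ 0 := by exact_mod_cast hs.ne'
    push_cast
    rw [Complex.I_sq]
    field_simp

theorem energy_sub_nonneg_and_eq_gaussian {s : ℝ} (hs : 0 < s) :
    0 ≤ energy (fun x y : E => Real.exp (-s * ‖x - y‖ ^ 2)) μ μ +
        energy (fun x y : E => Real.exp (-s * ‖x - y‖ ^ 2)) ν ν -
        2 * energy (fun x y : E => Real.exp (-s * ‖x - y‖ ^ 2)) μ ν ∧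
      (energy (fun x y : E => Real.exp (-s * ‖x - y‖ ^ 2)) μ μ +
        energy (fun x y : E => Real.exp (-s * ‖x - y‖ ^ 2)) ν ν -
        2 * energy (fun x y : E => Real.exp (-s * ‖x - y‖ ^ 2)) μ ν = 0 → μ = ν) := by
  obtain ⟨γ, hfin, hac, hγ⟩ := exists_measure_charFun_gaussian (E := E) hs
  exact energy_sub_nonneg_and_eq_of_charFun hac fun x y => (hγ (x - y)).symm

end CharacteristicFunction

/-! ### Mixtures of positive definite kernels -/

section Mixture

variable {X T : Type*} [MeasurableSpace X] [MeasurableSpace T] {τ : Measure T} [SFinite τ]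
  {w : T → ℝ} {κ : T → X → X → ℝ} {k : X → X → ℝ} {μ ν : Measure X} [IsFiniteMeasure μ]
  [IsFiniteMeasure ν]

theorem energy_mixture (hw : Integrable w τ)
    (hκ : Measurable fun p : (X × X) × T => κ p.2 p.1.1 p.1.2) (hκ1 : ∀ t x y, |κ t x y| ≤ 1)
    (hk : ∀ x y, k x y = ∫ t, w t * κ t x y ∂τ) :
    energy k μ ν = ∫ t, w t * energy (κ t) μ ν ∂τ ∧
      Integrable (fun t => w t * energy (κ t) μ ν) τ := by
  have hint : Integrable (fun p : (X × X) × T => w p.2 * κ p.2 p.1.1 p.1.2)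
      ((μ.prod ν).prod τ) := by
    refine (hw.comp_snd (μ.prod ν)).norm.mono'
      ((hw.comp_snd (μ.prod ν)).aestronglyMeasurable.mul hκ.aestronglyMeasurable)
      (Eventually.of_forall fun p => ?_)
    rw [norm_mul]
    exact mul_le_of_le_one_right (norm_nonneg _) (hκ1 _ _ _)
  have hκt : ∀ t, ∫ p, κ t p.1 p.2 ∂(μ.prod ν) = energy (κ t) μ ν := by
    intro t
    refine MeasureTheory.integral_prod _ (Integrable.of_bound (Measurable.aestronglyMeasurable ?_)
      1 (Eventually.of_forall fun p => hκ1 _ _ _))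
    exact hκ.comp (measurable_id.prodMk measurable_const)
  have e : ∀ t, ∫ p, w t * κ t p.1 p.2 ∂(μ.prod ν) = w t * energy (κ t) μ ν := fun t => by
    rw [integral_const_mul, hκt]
  constructor
  · have h1 : energy k μ ν = ∫ p, ∫ t, w t * κ t p.1 p.2 ∂τ ∂(μ.prod ν) := by
      rw [MeasureTheory.integral_prod _ hint.integral_prod_left, energy]
      simp only [hk]
    rw [h1, integral_integral_swap (f := fun (p : X × X) t => w t * κ t p.1 p.2) hint]
    simp only [e]
  · have := hint.integral_prod_right
    simpa only [e] using this

/-- By Fubini the energy is the average of the energies of the `κ t` with positive weights. If the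
average of the nonnegative terms vanishes, almost every term does, and `τ ≠ 0` supplies one such
`t`. -/
theorem energy_sub_nonneg_and_eq_mixture (hw : Integrable w τ) (hw0 : ∀ t, 0 < w t)
    (hτ : τ ≠ 0) (hκ : Measurable fun p : (X × X) × T => κ p.2 p.1.1 p.1.2)
    (hκ1 : ∀ t x y, |κ t x y| ≤ 1) (hk : ∀ x y, k x y = ∫ t, w t * κ t x y ∂τ)
    (hpos : ∀ᵐ t ∂τ, 0 ≤ energy (κ t) μ μ + energy (κ t) ν ν - 2 * energy (κ t) μ ν ∧
      (energy (κ t) μ μ + energy (κ t) ν ν - 2 * energy (κ t) μ ν = 0 → μ = ν)) :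
    0 ≤ energy k μ μ + energy k ν ν - 2 * energy k μ ν ∧
      (energy k μ μ + energy k ν ν - 2 * energy k μ ν = 0 → μ = ν) := by
  obtain ⟨e1, i1⟩ := energy_mixture (μ := μ) (ν := μ) hw hκ hκ1 hk
  obtain ⟨e2, i2⟩ := energy_mixture (μ := ν) (ν := ν) hw hκ hκ1 hk
  obtain ⟨e3, i3⟩ := energy_mixture (μ := μ) (ν := ν) hw hκ hκ1 hk
  have hi := (i1.add i2).sub (i3.const_mul 2)
  have e : energy k μ μ + energy k ν ν - 2 * energy k μ ν =
      ∫ t, w t * (energy (κ t) μ μ + energy (κ t) ν ν - 2 * energy (κ t) μ ν) ∂τ := by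
    rw [e1, e2, e3, ← integral_const_mul, ← integral_add i1 i2,
      ← integral_sub (by exact i1.add i2) (i3.const_mul 2)]
    refine integral_congr_ae (Eventually.of_forall fun t => ?_)
    simp only
    ring
  have hnn : 0 ≤ᵐ[τ] fun t =>
      w t * (energy (κ t) μ μ + energy (κ t) ν ν - 2 * energy (κ t) μ ν) :=
    hpos.mono fun t ht => mul_nonneg (hw0 t).le ht.1
  rw [e]
  refine ⟨integral_nonneg_of_ae hnn, fun h => ?_⟩
  rw [integral_eq_zero_iff_of_nonneg_ae hnn (hi.congr (Eventually.of_forall fun t => by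
    simp only [Pi.sub_apply, Pi.add_apply]; ring))] at h
  have : NeZero τ := ⟨hτ⟩
  obtain ⟨t, ht, hpt⟩ := (h.and hpos).exists
  exact hpt.2 ((mul_eq_zero.1 ht).resolve_left (hw0 t).ne')

end Mixture

/-! ### The Laplace kernel as a mixture of Gaussians -/

section Laplace

/-- The Cauchy–Schlömilch formula for the Gaussian function. -/
theorem integral_exp_neg_sub_div_sq {a : ℝ} (ha : 0 ≤ a) :
    ∫ u in Ioi (0 : ℝ), Real.exp (-(u - a / u) ^ 2) = √Real.pi / 2 := by
  rcases ha.eq_or_lt with rfl | ha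
  · simpa using integral_gaussian_Ioi 1
  have hinj : StrictMonoOn (fun u : ℝ => u - a / u) (Ioi 0) := by
    intro u hu v hv huv
    have : a / v < a / u := div_lt_div_of_pos_left ha hu huv
    simp only
    linarith
  have hsurj : (fun u : ℝ => u - a / u) '' Ioi 0 = univ := by
    refine eq_univ_of_forall fun z => ?_
    have hsq : 0 ≤ z ^ 2 + 4 * a := by positivity
    have h1 : √(z ^ 2 + 4 * a) ^ 2 = z ^ 2 + 4 * a := Real.sq_sqrt hsq
    have h2 : 0 < z + √(z ^ 2 + 4 * a) := by
      have : |z| < √(z ^ 2 + 4 * a) := by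
        rw [← Real.sqrt_sq_eq_abs]
        exact Real.sqrt_lt_sqrt (sq_nonneg _) (by linarith)
      linarith [neg_abs_le z]
    -- The positive root of `u ^ 2 - z u - a = 0`.
    refine ⟨(z + √(z ^ 2 + 4 * a)) / 2, half_pos h2, ?_⟩
    simp only
    field_simp
    nlinarith
  have hderiv : ∀ u ∈ Ioi (0 : ℝ),
      HasDerivWithinAt (fun u : ℝ => u - a / u) (1 + a / u ^ 2) (Ioi 0) u := by
    intro u hu
    have hu' : u ≠ 0 := (mem_Ioi.1 hu).ne'
    have := (hasDerivAt_id u).sub ((hasDerivAt_inv hu').const_mul a)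
    refine HasDerivAt.hasDerivWithinAt ?_
    refine this.congr_deriv ?_
    simp [div_eq_mul_inv]
  have hderiv' : ∀ u ∈ Ioi (0 : ℝ),
      HasDerivWithinAt (fun u : ℝ => a / u) (-(a / u ^ 2)) (Ioi 0) u := by
    intro u hu
    have hu' : u ≠ 0 := (mem_Ioi.1 hu).ne'
    have := (hasDerivAt_inv hu').const_mul a
    refine HasDerivAt.hasDerivWithinAt ?_
    refine this.congr_deriv ?_
    simp [div_eq_mul_inv]
  have himg : (fun u : ℝ => a / u) '' Ioi 0 = Ioi 0 := by
    refine Subset.antisymm ?_ fun u hu => ⟨a / u, div_pos ha hu, ?_⟩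
    · rintro _ ⟨u, hu, rfl⟩
      exact div_pos ha hu
    · have := (mem_Ioi.1 hu).ne'
      field_simp
  have hinj' : InjOn (fun u : ℝ => a / u) (Ioi 0) := by
    intro u hu v hv huv
    have hu' := (mem_Ioi.1 hu).ne'
    have hv' := (mem_Ioi.1 hv).ne'
    simp only at huv
    field_simp at huv
    exact huv.symm
  have hg : Integrable fun z : ℝ => Real.exp (-z ^ 2) := by
    simpa using integrable_exp_neg_mul_sq one_pos
  have habs : ∀ u : ℝ, |1 + a / u ^ 2| = 1 + a / u ^ 2 := fun u => abs_of_nonneg (by positivity)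
  have hint : IntegrableOn (fun u : ℝ => (1 + a / u ^ 2) * Real.exp (-(u - a / u) ^ 2))
      (Ioi 0) := by
    have := (integrableOn_image_iff_integrableOn_abs_deriv_smul measurableSet_Ioi hderiv
      hinj.injOn (fun z => Real.exp (-z ^ 2))).1 (by rw [hsurj]; exact hg.integrableOn)
    simpa only [habs, smul_eq_mul] using this
  have hsub := integral_image_eq_integral_abs_deriv_smul measurableSet_Ioi hderiv hinj.injOn
    (fun z => Real.exp (-z ^ 2))
  have hinv := integral_image_eq_integral_abs_deriv_smul measurableSet_Ioi hderiv' hinj'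
    (fun u => Real.exp (-(u - a / u) ^ 2))
  rw [hsurj, setIntegral_univ] at hsub
  rw [himg] at hinv
  simp only [habs, smul_eq_mul] at hsub
  have hgauss : ∫ z : ℝ, Real.exp (-z ^ 2) = √Real.pi := by simpa using integral_gaussian 1
  have hm : Measurable fun u : ℝ => Real.exp (-(u - a / u) ^ 2) := by fun_prop
  have hint₁ : IntegrableOn (fun u : ℝ => Real.exp (-(u - a / u) ^ 2)) (Ioi 0) := by
    refine Integrable.mono' hint hm.aestronglyMeasurable (Eventually.of_forall fun u => ?_)
    rw [Real.norm_of_nonneg (Real.exp_pos _).le]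
    have : 0 ≤ a / u ^ 2 := by positivity
    nlinarith [Real.exp_pos (-(u - a / u) ^ 2)]
  -- The inversion `u ↦ a / u` only changes the sign of `u - a / u`. It exchanges the two parts of
  -- the weight `1 + a / u ^ 2`, so each carries half of `√π`.
  have hinv' : ∫ u in Ioi (0 : ℝ), Real.exp (-(u - a / u) ^ 2) =
      ∫ u in Ioi (0 : ℝ), (a / u ^ 2) * Real.exp (-(u - a / u) ^ 2) := by
    rw [hinv]
    refine setIntegral_congr_fun measurableSet_Ioi fun u hu => ?_
    have hu' := (mem_Ioi.1 hu).ne'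
    have e1 : |-(a / u ^ 2)| = a / u ^ 2 := by rw [abs_neg, abs_of_nonneg (by positivity)]
    have e2 : a / (a / u) = u := by field_simp
    simp only [e1, e2, smul_eq_mul]
    congr 2
    ring
  have hsplit : ∫ u in Ioi (0 : ℝ), (1 + a / u ^ 2) * Real.exp (-(u - a / u) ^ 2) =
      (∫ u in Ioi (0 : ℝ), Real.exp (-(u - a / u) ^ 2)) +
        ∫ u in Ioi (0 : ℝ), (a / u ^ 2) * Real.exp (-(u - a / u) ^ 2) := by
    have hint₂ : IntegrableOn (fun u : ℝ => (a / u ^ 2) * Real.exp (-(u - a / u) ^ 2))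
        (Ioi 0) := by
      refine (hint.sub hint₁).congr (Eventually.of_forall fun u => ?_)
      simp only [Pi.sub_apply]
      ring
    rw [← integral_add hint₁ hint₂]
    refine integral_congr_ae (Eventually.of_forall fun u => ?_)
    simp only
    ring
  rw [hgauss, hsplit, ← hinv'] at hsub
  linarith

/-- The exponential function as a mixture of Gaussian functions. -/
theorem exp_neg_eq_integral_gaussian {r : ℝ} (hr : 0 ≤ r) :
    Real.exp (-r) = ∫ u in Ioi (0 : ℝ),
      (2 / √Real.pi * Real.exp (-u ^ 2)) * Real.exp (-(1 / (4 * u ^ 2)) * r ^ 2) := by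
  have h := integral_exp_neg_sub_div_sq (div_nonneg hr zero_le_two)
  have hpi : 0 < √Real.pi := Real.sqrt_pos.2 Real.pi_pos
  have e : ∀ u ∈ Ioi (0 : ℝ),
      (2 / √Real.pi * Real.exp (-u ^ 2)) * Real.exp (-(1 / (4 * u ^ 2)) * r ^ 2) =
      (2 / √Real.pi * Real.exp (-r)) * Real.exp (-(u - r / 2 / u) ^ 2) := by
    intro u hu
    have hu' := (mem_Ioi.1 hu).ne'
    rw [mul_assoc, mul_assoc, ← Real.exp_add, ← Real.exp_add]
    -- Completing the square: `u ^ 2 + r ^ 2 / (4 u ^ 2) = (u - r / (2 u)) ^ 2 + r`.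
    congr 2
    field_simp
    ring
  rw [setIntegral_congr_fun measurableSet_Ioi e, integral_const_mul, h]
  field_simp

variable {E : Type*} [NormedAddCommGroup E] [InnerProductSpace ℝ E] [FiniteDimensional ℝ E]
  [MeasurableSpace E] [BorelSpace E] {ε : ℝ}

theorem isPositiveDefinite_gibbsKernel_norm (hε : 0 < ε) :
    IsPositiveDefinite (gibbsKernel (fun x y : E => ‖x - y‖) ε) := by
  intro B _ μ ν _ _ _ _
  refine energy_sub_nonneg_and_eq_mixture (τ := volume.restrict (Ioi (0 : ℝ)))
    (w := fun u => 2 / √Real.pi * Real.exp (-u ^ 2))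
    -- The mixture formula at `r = ‖x - y‖ / ε`; each component is Gaussian of parameter `1 / (4 u ^
    -- 2 ε ^ 2)`.
    (κ := fun u x y => Real.exp (-(1 / (4 * u ^ 2) / ε ^ 2) * ‖x - y‖ ^ 2)) ?_ ?_ ?_ ?_ ?_ ?_ ?_
  · have : Integrable fun z : ℝ => Real.exp (-z ^ 2) := by
      simpa using integrable_exp_neg_mul_sq one_pos
    exact (this.const_mul _).integrableOn
  · intro u
    have := Real.pi_pos
    positivity
  · rw [Ne, Measure.restrict_eq_zero]
    simp
  · fun_prop
  · intro u x y
    rw [abs_of_pos (Real.exp_pos _), Real.exp_le_one_iff, neg_mul, neg_nonpos]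
    positivity
  · intro x y
    have e : gibbsKernel (fun x y : E => ‖x - y‖) ε x y = Real.exp (-(‖x - y‖ / ε)) := by
      rw [gibbsKernel, neg_div]
    rw [e, exp_neg_eq_integral_gaussian (by positivity)]
    refine integral_congr_ae (Eventually.of_forall fun u => ?_)
    simp only
    congr 2
    ring
  · refine (ae_restrict_mem measurableSet_Ioi).mono fun u hu => ?_
    have hu' : 0 < u := hu
    exact energy_sub_nonneg_and_eq_gaussian (by positivity)

theorem isPositiveDefinite_gibbsKernel_norm_sq (hε : 0 < ε) :
    IsPositiveDefinite (gibbsKernel (fun x y : E => ‖x - y‖ ^ 2) ε) := by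
  intro B _ μ ν _ _ _ _
  have e : gibbsKernel (fun x y : E => ‖x - y‖ ^ 2) ε =
      fun x y => Real.exp (-(1 / ε) * ‖x - y‖ ^ 2) := by
    ext x y
    rw [gibbsKernel]
    ring_nf
  rw [e]
  exact energy_sub_nonneg_and_eq_gaussian (by positivity)

end Laplace

theorem carriedBy_univ {X : Type*} [MeasurableSpace X] :
    carriedBy (univ : Set X) = univ :=
  eq_univ_of_forall fun α => by simp [carriedBy]

/-- Continuous costs on Euclidean space whose Gibbs kernel is positive definite. -/
theorem isSmoothConvexDivergence_euclideanSpace {d : ℕ}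
    {C : EuclideanSpace ℝ (Fin d) → EuclideanSpace ℝ (Fin d) → ℝ} {ε : ℝ} (hε : 0 < ε)
    (hC : Continuous fun p : EuclideanSpace ℝ (Fin d) × EuclideanSpace ℝ (Fin d) => C p.1 p.2)
    (hsymm : ∀ x y, C x y = C y x) (hk : IsPositiveDefinite (gibbsKernel C ε)) :
    IsSmoothConvexDivergence (divergence C ε) (boundedSupport (EuclideanSpace ℝ (Fin d)))
      (commonBall d) := by
  refine isSmoothConvexDivergence_divergence hC hsymm hε hk ?_ ?_
  · rintro α ⟨B, hB, hα⟩
    exact ⟨closure B, hB.isCompact_closure, carriedBy_mono subset_closure hα⟩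
  · rintro N ⟨R, rfl⟩
    exact ⟨Metric.closedBall 0 R, isCompact_closedBall 0 R, rfl⟩

end Sinkhorn

end

theorem theorem1 :
    (∀ (X : Type*) [MetricSpace X] [CompactSpace X] [MeasurableSpace X] [BorelSpace X]
      (C : X → X → ℝ) (K : NNReal) (ε : ℝ),
      (∀ x y, C x y = C y x) →
      LipschitzWith K (fun p : X × X => C p.1 p.2) →
      0 < ε →
      Sinkhorn.IsPositiveKernel (Sinkhorn.gibbsKernel C ε) →
      Sinkhorn.IsUniversalKernel (Sinkhorn.gibbsKernel C ε) →
      Sinkhorn.IsSmoothConvexDivergence (Sinkhorn.divergence C ε) Set.univ {Set.univ}) ∧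
    (∀ (d : ℕ) (ε : ℝ), 0 < ε →
      Sinkhorn.IsSmoothConvexDivergence
        (Sinkhorn.divergence (fun x y : EuclideanSpace ℝ (Fin d) => ‖x - y‖) ε)
        (Sinkhorn.boundedSupport (EuclideanSpace ℝ (Fin d))) (Sinkhorn.commonBall d)) ∧
    (∀ (d : ℕ) (ε : ℝ), 0 < ε →
      Sinkhorn.IsSmoothConvexDivergence
        (Sinkhorn.divergence (fun x y : EuclideanSpace ℝ (Fin d) => ‖x - y‖ ^ 2) ε)
        (Sinkhorn.boundedSupport (EuclideanSpace ℝ (Fin d))) (Sinkhorn.commonBall d)) := by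
  refine ⟨?_, ?_, ?_⟩
  · intro X _ _ _ _ C K ε hsymm hC hε hpos huniv
    have hk : Continuous fun p : X × X => Sinkhorn.gibbsKernel C ε p.1 p.2 :=
      Real.continuous_exp.comp (hC.continuous.neg.div_const ε)
    refine Sinkhorn.isSmoothConvexDivergence_divergence hC.continuous hsymm hε
      (Sinkhorn.isPositiveDefinite_of_universal hk hpos huniv)
      (fun α _ => ⟨Set.univ, isCompact_univ, ?_⟩) fun N hN =>
        ⟨Set.univ, isCompact_univ, hN.trans Sinkhorn.carriedBy_univ.symm⟩
    exact Sinkhorn.carriedBy_univ (X := X).symm ▸ Set.mem_univ α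
  · exact fun d ε hε => Sinkhorn.isSmoothConvexDivergence_euclideanSpace hε (by fun_prop)
      (fun x y => norm_sub_rev x y) (Sinkhorn.isPositiveDefinite_gibbsKernel_norm hε)
  · exact fun d ε hε => Sinkhorn.isSmoothConvexDivergence_euclideanSpace hε (by fun_prop)
      (fun x y => by rw [norm_sub_rev]) (Sinkhorn.isPositiveDefinite_gibbsKernel_norm_sq hε)
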